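/- For every $k\in\mathbb N$ let $A_k\in\mathbb{R}^{n_k\times d_k}$ be a (deterministic or random) data matrix, and let $S_k\in\mathbb{R}^{m_k\times n_k}$ be a Gaussian projection, independent of the data: its entries are i.i.d. $\mathcal N(0,1/m_k)$. Suppose that $m_k\to\infty$, $d_k\to\infty$ and $d_k/m_k\to y$ with $y\in[0,1)$. Write $\Gamma_k=\frac1{n_k}A_k^TA_k$ and, for fixed $\lambda>0$, $$H_k=\Gamma_k+\lambda I,\qquad H_{S,k}=\tfrac1{n_k}A_k^TS_k^TS_kA_k+\lambda I,\qquad d_\lambda^k=\mathrm{tr}\big(\Gamma_k(\Gamma_k+\lambda I)^{-1}\big).$$ Assume that the following hold almost surely (with respect to the data): 1. there is a (nonrandom) function $F$ such that for almost every $u\ge 0$ the empirical spectral distribution functions $F_{\Gamma_k}(u)=\frac1{d_k}\#\{i:\lambda_i(\Gamma_k)\le u\}$ converge to $F(u)$ as $k\to\infty$; 2. for every $k$ all eigenvalues of $\Gamma_k$ lie in an interval $[\sigma_{\min,k},\sigma_{\max}]$, where $\sigma_{\min,k}>0$ and $\sigma_{\max}$ are nonrandom and $\sigma_{\max}$ does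 not depend on $k$; 3. $d_\lambda^k<m_k$ for every $k$. Then, almost surely with respect to the data, for every $k$ the random matrix $\Big(\frac{1}{1-d_\lambda^k/m_k}(H_{S,k}-\lambda I)+\lambda I\Big)^{-1}$ is integrable over the sketch, and $$\lim_{k\to\infty}\left\|\mathbb{E}_{S}\left[\Big(\frac{1}{1-d_\lambda^k/m_k}(H_{S,k}-\lambda I)+\lambda I\Big)^{-1}\right]-H_k^{-1}\right\|=0,$$ where $\mathbb{E}_S$ is the expectation over the sketch $S_k$ with the data matrix held fixed and $\|\cdot\|$ is the operator (spectral) norm. If the $A_k$ are deterministic, all "almost surely with respect to the data" qualifications are void. -/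

import Mathlib

open MeasureTheory ProbabilityTheory Filter Topology
open scoped NNReal Matrix Matrix.Norms.L2Operator

noncomputable section

namespace HessianSketch

/-- The matrix `n⁻¹ AᵀA` of a data matrix `A` with `n` rows. -/
def scaledGram {n d : ℕ} (A : Matrix (Fin n) (Fin d) ℝ) : Matrix (Fin d) (Fin d) ℝ :=
  (n : ℝ)⁻¹ • (Aᵀ * A)

theorem scaledGram_isHermitian {n d : ℕ} (A : Matrix (Fin n) (Fin d) ℝ) :
    (scaledGram A).IsHermitian := by
  rw [Matrix.IsHermitian, scaledGram, Matrix.conjTranspose_eq_transpose_of_trivial,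
    Matrix.transpose_smul, Matrix.transpose_mul, Matrix.transpose_transpose]

/-- The eigenvalues of `n⁻¹ AᵀA`, with multiplicity. -/
def gramEigenvalues {n d : ℕ} (A : Matrix (Fin n) (Fin d) ℝ) : Fin d → ℝ :=
  (scaledGram_isHermitian A).eigenvalues

/-- The empirical spectral distribution function of `n⁻¹ AᵀA`: the fraction of the `d`
eigenvalues that are at most `u`. -/
def gramESD {n d : ℕ} (A : Matrix (Fin n) (Fin d) ℝ) (u : ℝ) : ℝ :=
  (d : ℝ)⁻¹ * ∑ i : Fin d, Set.indicator (Set.Iic u) (fun _ => (1 : ℝ)) (gramEigenvalues A i)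

/-- The effective dimension `tr (Γ (Γ + lam I)⁻¹)`. -/
def effectiveDim {d : ℕ} (lam : ℝ) (Γ : Matrix (Fin d) (Fin d) ℝ) : ℝ :=
  (Γ * (Γ + lam • (1 : Matrix (Fin d) (Fin d) ℝ))⁻¹).trace

/-- The regularized Hessian `H = n⁻¹ AᵀA + lam I`. -/
def hessian {n d : ℕ} (lam : ℝ) (A : Matrix (Fin n) (Fin d) ℝ) : Matrix (Fin d) (Fin d) ℝ :=
  scaledGram A + lam • (1 : Matrix (Fin d) (Fin d) ℝ)

/-- The sketched Hessian `H_S = n⁻¹ AᵀSᵀSA + lam I`. -/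
def sketchedHessian {m n d : ℕ} (lam : ℝ) (A : Matrix (Fin n) (Fin d) ℝ)
    (S : Matrix (Fin m) (Fin n) ℝ) : Matrix (Fin d) (Fin d) ℝ :=
  (n : ℝ)⁻¹ • (Aᵀ * Sᵀ * S * A) + lam • (1 : Matrix (Fin d) (Fin d) ℝ)

/-- The shrinkage estimator `((1 - d_lam / m)⁻¹ (H_S - lam I) + lam I)⁻¹` of `H⁻¹`, where
`d_lam` is the effective dimension of `n⁻¹ AᵀA`. -/
def shrunkInverse {m n d : ℕ} (lam : ℝ) (A : Matrix (Fin n) (Fin d) ℝ)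
    (S : Matrix (Fin m) (Fin n) ℝ) : Matrix (Fin d) (Fin d) ℝ :=
  ((1 - effectiveDim lam (scaledGram A) / (m : ℝ))⁻¹ •
      (sketchedHessian lam A S - lam • (1 : Matrix (Fin d) (Fin d) ℝ)) +
    lam • (1 : Matrix (Fin d) (Fin d) ℝ))⁻¹

/-- `S` is an `m × n` Gaussian projection: its entries are independent with law `N(0, 1/m)`. -/
structure IsGaussianProjection {Ω : Type*} [MeasurableSpace Ω] (P : Measure Ω) {m n : ℕ}
    (S : Ω → Matrix (Fin m) (Fin n) ℝ) : Prop where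
  indep : iIndepFun (fun (p : Fin m × Fin n) (ω : Ω) => S ω p.1 p.2) P
  law : ∀ i j, HasLaw (fun ω => S ω i j) (gaussianReal 0 ((m : ℝ≥0)⁻¹)) P

end HessianSketch

end

/-! Write `Γ` for `scaledGram A` and `a = (1 - d_lam/m)⁻¹`. The rows of `√m S` are independent
standard Gaussian vectors, so the `x_i = n^(-1/2) Aᵀ (√m S_i)` are i.i.d. with covariance `Γ`, and
the shrunk inverse is the resolvent `R = ((a/m) ∑ x_i x_iᵀ + lam I)⁻¹` of a sample covariance matrix
(`shrunkInverse_eq_sampleResolvent`).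

Sherman-Morrison turns the identity `R R⁻¹ = I` into `I = lam R + (a/m) ∑ R_i x_i x_iᵀ / q_i`, where
`R_i` omits `x_i` and `q_i = 1 + (a/m) x_iᵀ R_i x_i`. Given the other vectors, `x_iᵀ R_i x_i` has
mean `tr(Γ R_i)` and variance `O(d)`, while `tr(Γ R)` has variance `O(m)` by bounded differences.
For `d ≤ m`, `q_i` is therefore within `O(m^(-1/2))` in L² of the constant `τ = 1 + (a/m) tr(Γ E
R)`, and `E R ((a/τ) Γ + lam I) = I + O(m^(-1/2))` in operator norm
(`HasQuadraticMoments.norm_one_sub_resolvent_equation_le`).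

The shrinkage factor makes `H⁻¹` an exact solution: for `R = H⁻¹` the trace is `d_lam` and `1 + a
d_lam/m = a`, so the coefficient of `Γ` is 1. The equation is stable
(`norm_sub_resolvent_le_of_approx`), so `E R` is close to `H⁻¹`. The constants involve only `lam`
and bounds on `a` and `‖Γ‖`; the latter come from `d_lam ≤ d`, `d/m → y < 1` and the spectral bound
`σmax`. -/

namespace HessianSketch

/-! ### Operator norm and trace bounds through dot products. -/

section NormBounds

variable {d : ℕ}

theorem norm_toLp_sq (u : Fin d → ℝ) : ‖WithLp.toLp 2 u‖ ^ 2 = u ⬝ᵥ u := by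
  rw [EuclideanSpace.real_norm_sq_eq]
  simp [dotProduct, sq]

theorem norm_toLp_eq_one {u : Fin d → ℝ} (hu : u ⬝ᵥ u = 1) : ‖WithLp.toLp 2 u‖ = 1 := by
  have h := norm_toLp_sq u
  rw [hu] at h
  exact (pow_eq_one_iff_of_nonneg (norm_nonneg _) two_ne_zero).mp h

theorem abs_dotProduct_le (u v : Fin d → ℝ) :
    |u ⬝ᵥ v| ≤ ‖WithLp.toLp 2 u‖ * ‖WithLp.toLp 2 v‖ := by
  have h := abs_real_inner_le_norm (WithLp.toLp 2 u) (WithLp.toLp 2 v)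
  simpa [PiLp.inner_apply, dotProduct, mul_comm] using h

theorem norm_toLp_mulVec_le (B : Matrix (Fin d) (Fin d) ℝ) (u : Fin d → ℝ) :
    ‖WithLp.toLp 2 (B *ᵥ u)‖ ≤ ‖B‖ * ‖WithLp.toLp 2 u‖ :=
  B.l2_opNorm_mulVec (WithLp.toLp 2 u)

theorem mulVec_dotProduct_self_le (B : Matrix (Fin d) (Fin d) ℝ) (u : Fin d → ℝ) :
    (B *ᵥ u) ⬝ᵥ (B *ᵥ u) ≤ ‖B‖ ^ 2 * (u ⬝ᵥ u) := by
  rw [← norm_toLp_sq, ← norm_toLp_sq, ← mul_pow]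
  exact pow_le_pow_left₀ (norm_nonneg _) (norm_toLp_mulVec_le B u) 2

theorem abs_dotProduct_mulVec_le (B : Matrix (Fin d) (Fin d) ℝ) {u v : Fin d → ℝ}
    (hu : u ⬝ᵥ u = 1) (hv : v ⬝ᵥ v = 1) : |u ⬝ᵥ B *ᵥ v| ≤ ‖B‖ := by
  refine (abs_dotProduct_le _ _).trans ?_
  rw [norm_toLp_eq_one hu, one_mul]
  have := norm_toLp_mulVec_le B v
  rwa [norm_toLp_eq_one hv, mul_one] at this

theorem dotProduct_mulVec_self_le (B : Matrix (Fin d) (Fin d) ℝ) (u : Fin d → ℝ) :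
    u ⬝ᵥ B *ᵥ u ≤ ‖B‖ * (u ⬝ᵥ u) := by
  rw [← norm_toLp_sq]
  calc u ⬝ᵥ B *ᵥ u ≤ ‖WithLp.toLp 2 u‖ * ‖WithLp.toLp 2 (B *ᵥ u)‖ :=
        (le_abs_self _).trans (abs_dotProduct_le _ _)
    _ ≤ ‖WithLp.toLp 2 u‖ * (‖B‖ * ‖WithLp.toLp 2 u‖) := by
        gcongr
        exact norm_toLp_mulVec_le B u
    _ = _ := by ring

theorem norm_le_of_mulVec_dotProduct_self_le {B : Matrix (Fin d) (Fin d) ℝ} {C : ℝ} (hC : 0 ≤ C)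
    (h : ∀ u, (B *ᵥ u) ⬝ᵥ (B *ᵥ u) ≤ C ^ 2 * (u ⬝ᵥ u)) : ‖B‖ ≤ C := by
  rw [Matrix.l2_opNorm_def]
  refine ContinuousLinearMap.opNorm_le_bound _ hC fun x => ?_
  have h1 := h x.ofLp
  rw [← norm_toLp_sq, ← norm_toLp_sq, ← mul_pow] at h1
  exact le_of_sq_le_sq h1 (by positivity)

theorem norm_le_of_abs_dotProduct_mulVec_le {B : Matrix (Fin d) (Fin d) ℝ} {C : ℝ} (hC : 0 ≤ C)
    (h : ∀ u v, u ⬝ᵥ u = 1 → v ⬝ᵥ v = 1 → |u ⬝ᵥ B *ᵥ v| ≤ C) : ‖B‖ ≤ C := by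
  refine norm_le_of_mulVec_dotProduct_self_le hC fun v => ?_
  have hnorm : ∀ w : Fin d → ℝ, w ≠ 0 →
      (‖WithLp.toLp 2 w‖⁻¹ • w) ⬝ᵥ (‖WithLp.toLp 2 w‖⁻¹ • w) = 1 := by
    intro w hw
    have : ‖WithLp.toLp 2 w‖ ≠ 0 := by simpa using hw
    rw [smul_dotProduct, dotProduct_smul, ← norm_toLp_sq, smul_eq_mul, smul_eq_mul]
    field_simp
  by_cases hw : B *ᵥ v = 0
  · rw [hw, zero_dotProduct]
    exact mul_nonneg (sq_nonneg _) (by rw [← norm_toLp_sq]; positivity)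
  have hv : v ≠ 0 := by
    rintro rfl
    simp at hw
  have h1 := (le_abs_self _).trans (h _ _ (hnorm _ hw) (hnorm _ hv))
  rw [Matrix.mulVec_smul, smul_dotProduct, dotProduct_smul, ← norm_toLp_sq, smul_eq_mul,
    smul_eq_mul] at h1
  rw [← norm_toLp_sq, ← norm_toLp_sq, ← mul_pow]
  have p1 : 0 < ‖WithLp.toLp 2 v‖ := by simpa using hv
  have p2 : 0 < ‖WithLp.toLp 2 (B *ᵥ v)‖ := by simpa using hw
  refine pow_le_pow_left₀ p2.le ?_ 2
  field_simp at h1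
  linarith

theorem abs_trace_le (B : Matrix (Fin d) (Fin d) ℝ) : |B.trace| ≤ d * ‖B‖ := by
  rw [Matrix.trace]
  refine (Finset.abs_sum_le_sum_abs _ _).trans ?_
  refine (Finset.sum_le_sum (g := fun _ => ‖B‖) fun i _ => ?_).trans (by simp)
  have h := abs_dotProduct_mulVec_le B (u := Pi.single i 1) (v := Pi.single i 1) (by simp) (by simp)
  simpa using h

end NormBounds

/-! ### Resolvents of positive semidefinite matrices and rank one updates. -/

section Resolvent

variable {d : ℕ} {lam : ℝ} {K : Matrix (Fin d) (Fin d) ℝ}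

theorem isUnit_det_add_smul_one (hlam : 0 < lam) (hK : K.PosSemidef) :
    IsUnit (K + lam • (1 : Matrix (Fin d) (Fin d) ℝ)).det :=
  (Matrix.isUnit_iff_isUnit_det _).mp
    (Matrix.PosDef.isUnit (Matrix.PosDef.posSemidef_add hK (Matrix.PosDef.one.smul hlam)))

theorem resolvent_mul (hlam : 0 < lam) (hK : K.PosSemidef) :
    (K + lam • (1 : Matrix (Fin d) (Fin d) ℝ))⁻¹ * (K + lam • 1) = 1 :=
  Matrix.nonsing_inv_mul _ (isUnit_det_add_smul_one hlam hK)

theorem mul_resolvent (hlam : 0 < lam) (hK : K.PosSemidef) :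
    (K + lam • (1 : Matrix (Fin d) (Fin d) ℝ)) * (K + lam • 1)⁻¹ = 1 :=
  Matrix.mul_nonsing_inv _ (isUnit_det_add_smul_one hlam hK)

theorem transpose_eq_of_posSemidef (hK : K.PosSemidef) : Kᵀ = K := by
  have := hK.isHermitian
  rwa [Matrix.IsHermitian, Matrix.conjTranspose_eq_transpose_of_trivial] at this

theorem dotProduct_mulVec_nonneg (hK : K.PosSemidef) (u : Fin d → ℝ) : 0 ≤ u ⬝ᵥ K *ᵥ u := by
  simpa using hK.dotProduct_mulVec_nonneg u

theorem transpose_resolvent (hK : K.PosSemidef) :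
    ((K + lam • (1 : Matrix (Fin d) (Fin d) ℝ))⁻¹)ᵀ = (K + lam • 1)⁻¹ := by
  rw [Matrix.transpose_nonsing_inv, Matrix.transpose_add, transpose_eq_of_posSemidef hK,
    Matrix.transpose_smul, Matrix.transpose_one]

theorem dotProduct_mulVec_comm_of_transpose_eq {B : Matrix (Fin d) (Fin d) ℝ} (hB : Bᵀ = B)
    (u v : Fin d → ℝ) : u ⬝ᵥ B *ᵥ v = (B *ᵥ u) ⬝ᵥ v := by
  rw [Matrix.dotProduct_mulVec, ← Matrix.mulVec_transpose, hB]

/-- With `w = R u` one has `u = K w + lam w`; pair this with `w` and drop `w ⬝ᵥ K w ≥ 0`. -/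
theorem mul_resolvent_dotProduct_self_le (hlam : 0 < lam) (hK : K.PosSemidef) (u : Fin d → ℝ) :
    lam * (((K + lam • (1 : Matrix (Fin d) (Fin d) ℝ))⁻¹ *ᵥ u) ⬝ᵥ
      ((K + lam • (1 : Matrix (Fin d) (Fin d) ℝ))⁻¹ *ᵥ u)) ≤
      u ⬝ᵥ (K + lam • (1 : Matrix (Fin d) (Fin d) ℝ))⁻¹ *ᵥ u := by
  set R := (K + lam • (1 : Matrix (Fin d) (Fin d) ℝ))⁻¹ with hR
  have h1 : K *ᵥ (R *ᵥ u) + lam • (R *ᵥ u) = u := by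
    have := congrArg (· *ᵥ u) (mul_resolvent hlam hK)
    simpa [← Matrix.mulVec_mulVec, Matrix.add_mulVec, Matrix.smul_mulVec] using this
  have h2 := dotProduct_mulVec_nonneg hK (R *ᵥ u)
  have h3 := congrArg (fun w => (R *ᵥ u) ⬝ᵥ w) h1
  simp only [dotProduct_add, dotProduct_smul, smul_eq_mul] at h3
  rw [dotProduct_comm u]
  linarith

theorem dotProduct_resolvent_nonneg (hlam : 0 < lam) (hK : K.PosSemidef) (u : Fin d → ℝ) :
    0 ≤ u ⬝ᵥ (K + lam • (1 : Matrix (Fin d) (Fin d) ℝ))⁻¹ *ᵥ u :=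
  (mul_nonneg hlam.le (by rw [← norm_toLp_sq]; positivity)).trans
    (mul_resolvent_dotProduct_self_le hlam hK u)

theorem norm_resolvent_le (hlam : 0 < lam) (hK : K.PosSemidef) :
    ‖(K + lam • (1 : Matrix (Fin d) (Fin d) ℝ))⁻¹‖ ≤ lam⁻¹ := by
  refine norm_le_of_mulVec_dotProduct_self_le (inv_nonneg.mpr hlam.le) fun u => ?_
  have h1 := mul_resolvent_dotProduct_self_le hlam hK u
  set w := (K + lam • (1 : Matrix (Fin d) (Fin d) ℝ))⁻¹ *ᵥ u
  -- Expanding the square and inserting `h1` gives `lam² |w|² ≤ |u|²`.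
  have h2 : 0 ≤ (u - lam • w) ⬝ᵥ (u - lam • w) := by rw [← norm_toLp_sq]; positivity
  simp only [dotProduct_sub, sub_dotProduct, dotProduct_smul, smul_dotProduct, smul_eq_mul,
    dotProduct_comm w u] at h2
  rw [inv_pow, ← div_eq_inv_mul, le_div_iff₀ (by positivity)]
  nlinarith [mul_le_mul_of_nonneg_left h1 hlam.le]

theorem posSemidef_smul_vecMulVec_self {t : ℝ} (ht : 0 ≤ t) (x : Fin d → ℝ) :
    (t • Matrix.vecMulVec x x).PosSemidef := by
  have := (Matrix.posSemidef_vecMulVec_self_star x).smul ht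
  simpa using this

/-- The Sherman-Morrison identity for the resolvent of a rank one update. -/
theorem resolvent_sub_resolvent_add_vecMulVec (hlam : 0 < lam) (hK : K.PosSemidef) {t : ℝ}
    (ht : 0 ≤ t) (x : Fin d → ℝ) :
    (K + lam • (1 : Matrix (Fin d) (Fin d) ℝ))⁻¹ -
        (K + t • Matrix.vecMulVec x x + lam • (1 : Matrix (Fin d) (Fin d) ℝ))⁻¹ =
      t • Matrix.vecMulVec
        ((K + t • Matrix.vecMulVec x x + lam • (1 : Matrix (Fin d) (Fin d) ℝ))⁻¹ *ᵥ x)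
        ((K + lam • (1 : Matrix (Fin d) (Fin d) ℝ))⁻¹ *ᵥ x) := by
  have hK' := hK.add (posSemidef_smul_vecMulVec_self ht x)
  have hRt := transpose_resolvent (lam := lam) hK
  have h1 := resolvent_mul hlam hK'
  have h2 := mul_resolvent hlam hK
  set R := (K + lam • (1 : Matrix (Fin d) (Fin d) ℝ))⁻¹
  set R' := (K + t • Matrix.vecMulVec x x + lam • (1 : Matrix (Fin d) (Fin d) ℝ))⁻¹
  have h3 : R - R' = R' * (K + t • Matrix.vecMulVec x x + lam • 1) * R -
      R' * ((K + lam • 1) * R) := by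
    rw [h1, h2, one_mul, mul_one]
  rw [h3, ← mul_assoc, ← sub_mul, ← mul_sub]
  have h4 : K + t • Matrix.vecMulVec x x + lam • (1 : Matrix (Fin d) (Fin d) ℝ) -
      (K + lam • 1) = t • Matrix.vecMulVec x x := by abel
  rw [h4, Matrix.mul_smul, Matrix.smul_mul, Matrix.mul_vecMulVec, Matrix.vecMulVec_mul,
    ← Matrix.mulVec_transpose, hRt]

/-- Apply the Sherman-Morrison identity to `x` itself: the two resolvents send `x` to parallel
vectors. -/
theorem resolvent_mulVec_eq_smul (hlam : 0 < lam) (hK : K.PosSemidef) {t : ℝ}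
    (ht : 0 ≤ t) (x : Fin d → ℝ) :
    (K + lam • (1 : Matrix (Fin d) (Fin d) ℝ))⁻¹ *ᵥ x =
      (1 + t * (x ⬝ᵥ (K + lam • (1 : Matrix (Fin d) (Fin d) ℝ))⁻¹ *ᵥ x)) •
        (K + t • Matrix.vecMulVec x x + lam • (1 : Matrix (Fin d) (Fin d) ℝ))⁻¹ *ᵥ x := by
  have h := congrArg (· *ᵥ x) (resolvent_sub_resolvent_add_vecMulVec hlam hK ht x)
  simp only [Matrix.sub_mulVec, Matrix.smul_mulVec, Matrix.vecMulVec_mulVec,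
    op_smul_eq_smul] at h
  rw [dotProduct_comm x, add_smul, one_smul, mul_smul, ← h]
  abel

end Resolvent

/-! ### Resampling a coordinate and the bounded difference variance inequality. -/

section ProductMeasure

variable {E : Type*} [MeasurableSpace E] {μ : Measure E} [IsProbabilityMeasure μ]

theorem integrable_of_abs_le {g : E → ℝ} {C : ℝ} (hg : Measurable g) (h : ∀ x, |g x| ≤ C) :
    Integrable g μ :=
  Integrable.of_bound hg.aestronglyMeasurable C (ae_of_all _ h)

theorem abs_integral_le_of_abs_le {g : E → ℝ} {C : ℝ} (h : ∀ x, |g x| ≤ C) :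
    |∫ x, g x ∂μ| ≤ C := by
  have h' : ∀ x, ‖g x‖ ≤ C := h
  simpa using norm_integral_le_of_norm_le_const (μ := μ) (ae_of_all _ h')

/-- Resampling one coordinate of an i.i.d. family does not change its law. -/
theorem measurePreserving_update {ι : Type*} [Fintype ι] [DecidableEq ι] (i : ι) :
    MeasurePreserving (fun p : (ι → E) × E => Function.update p.1 i p.2)
      ((Measure.pi fun _ => μ).prod μ) (Measure.pi fun _ => μ) := by
  have hmeas : Measurable fun p : (ι → E) × E => Function.update p.1 i p.2 := by
    refine measurable_pi_lambda _ fun j => ?_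
    by_cases hj : j = i
    · subst hj
      simpa using measurable_snd
    · simpa [hj, Function.comp_def] using (measurable_pi_apply j).comp measurable_fst
  refine ⟨hmeas, (Measure.pi_eq fun s hs => ?_).symm⟩
  rw [Measure.map_apply hmeas (MeasurableSet.univ_pi hs)]
  -- The old coordinate `i` is overwritten, hence unconstrained; `s i` constrains the fresh sample
  -- instead.
  have : (fun p : (ι → E) × E => Function.update p.1 i p.2) ⁻¹' Set.univ.pi s =
      (Set.univ.pi (Function.update s i Set.univ)) ×ˢ s i := by
    ext p
    simp only [Set.mem_preimage, Set.mem_univ_pi, Set.mem_prod]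
    constructor
    · intro h
      refine ⟨fun j => ?_, by simpa using h i⟩
      by_cases hj : j = i
      · subst hj; simp
      · simpa [hj] using h j
    · rintro ⟨h1, h2⟩ j
      by_cases hj : j = i
      · subst hj; simpa using h2
      · simpa [hj] using h1 j
  rw [this, Measure.prod_prod, Measure.pi_pi, ← Finset.mul_prod_erase _ _ (Finset.mem_univ i),
    ← Finset.mul_prod_erase (a := i) _ (fun j => μ (s j)) (Finset.mem_univ i)]
  simp only [Function.update_self, measure_univ, one_mul]
  rw [mul_comm]
  congr 1
  refine Finset.prod_congr rfl fun j hj => ?_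
  rw [Function.update_of_ne (Finset.ne_of_mem_erase hj)]

theorem integral_pi_eq_integral_integral_update {ι : Type*} [Fintype ι] [DecidableEq ι] (i : ι)
    {f : (ι → E) → ℝ} (hf : Integrable f (Measure.pi fun _ => μ)) :
    ∫ ξ, f ξ ∂(Measure.pi fun _ => μ) =
      ∫ ξ, ∫ x, f (Function.update ξ i x) ∂μ ∂(Measure.pi fun _ => μ) := by
  have hmp := measurePreserving_update (μ := μ) i
  have hf' : AEStronglyMeasurable f
      (((Measure.pi fun _ => μ).prod μ).map fun p : (ι → E) × E => Function.update p.1 i p.2) := by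
    rw [hmp.map_eq]
    exact hf.aestronglyMeasurable
  conv_lhs => rw [← hmp.map_eq]
  rw [integral_map hmp.measurable.aemeasurable hf', integral_prod]
  exact hmp.integrable_comp_of_integrable hf

/-- A bounded difference inequality for the variance. -/
theorem integral_sub_integral_sq_le_of_update {n : ℕ} {f : (Fin n → E) → ℝ} (hf : Measurable f)
    {M c : ℝ} (hM : ∀ ξ, |f ξ| ≤ M) (hc : ∀ ξ i y, |f ξ - f (Function.update ξ i y)| ≤ c) :
    ∫ ξ, (f ξ - ∫ η, f η ∂(Measure.pi fun _ => μ)) ^ 2 ∂(Measure.pi fun _ => μ) ≤ n * c ^ 2 := by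
  induction n with
  | zero =>
    have : ∀ ξ : Fin 0 → E, f ξ = f default := fun ξ => by rw [Subsingleton.elim ξ default]
    simp [this]
  | succ n ih =>
    set ν : Measure (Fin n → E) := Measure.pi fun _ => μ
    have hmp := (measurePreserving_piFinSuccAbove (fun _ : Fin (n + 1) => μ) 0).symm
    have hcons : ∀ p : E × (Fin n → E),
        (MeasurableEquiv.piFinSuccAbove (fun _ : Fin (n + 1) => E) 0).symm p =
          Fin.cons p.1 p.2 := fun p => by
      simp [MeasurableEquiv.piFinSuccAbove, Fin.insertNthEquiv]
    have hmc : Measurable fun p : E × (Fin n → E) => f (Fin.cons p.1 p.2) := by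
      simp_rw [← hcons]
      exact hf.comp (MeasurableEquiv.measurable _)
    have hpush : ∀ g : (Fin (n + 1) → E) → ℝ, Measurable g → ∀ C, (∀ ξ, |g ξ| ≤ C) →
        ∫ ξ, g ξ ∂(Measure.pi fun _ => μ) = ∫ x, ∫ ξ, g (Fin.cons x ξ) ∂ν ∂μ := by
      intro g hg C hC
      rw [← hmp.integral_comp' g]
      simp_rw [hcons]
      rw [integral_prod]
      refine integrable_of_abs_le (C := C) ?_ fun p => hC _
      simp_rw [← hcons]
      exact hg.comp (MeasurableEquiv.measurable _)
    set a := ∫ η, f η ∂(Measure.pi fun _ => μ) with ha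
    -- `g` is the conditional mean given the first coordinate. In `f - a = (f - g) + (g - a)` the
    -- cross term integrates to zero; the induction hypothesis bounds the first square by `n c²`,
    -- and `|g - a| ≤ c` bounds the second.
    set g : E → ℝ := fun x => ∫ ξ, f (Fin.cons x ξ) ∂ν with hg
    have hag : a = ∫ x, g x ∂μ := hpush f hf M hM
    have hfx : ∀ x, Measurable fun ξ : Fin n → E => f (Fin.cons x ξ) :=
      fun x => hmc.comp measurable_prodMk_left
    have hfi : ∀ x, Integrable (fun ξ : Fin n → E => f (Fin.cons x ξ)) ν :=
      fun x => integrable_of_abs_le (hfx x) fun ξ => hM _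
    have hgm : Measurable g := by
      exact hmc.stronglyMeasurable.integral_prod_right.measurable
    have hgM : ∀ x, |g x| ≤ M := fun x => by
      exact abs_integral_le_of_abs_le fun ξ => hM (Fin.cons x ξ)
    have hgi : Integrable g μ := integrable_of_abs_le hgm hgM
    have hgc : ∀ x y, |g x - g y| ≤ c := fun x y => by
      rw [hg]
      simp only
      rw [← integral_sub (hfi x) (hfi y)]
      have : ∀ ξ : Fin n → E, |f (Fin.cons x ξ) - f (Fin.cons y ξ)| ≤ c := fun ξ => by
        simpa using hc (Fin.cons x ξ) 0 y
      exact abs_integral_le_of_abs_le this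
    have hga : ∀ x, (g x - a) ^ 2 ≤ c ^ 2 := fun x => by
      have h1 : g x - a = ∫ y, (g x - g y) ∂μ := by
        rw [integral_sub (integrable_const _) hgi, hag]
        simp
      have h2 : |g x - a| ≤ c := by
        rw [h1]
        exact abs_integral_le_of_abs_le (hgc x)
      exact sq_le_sq' (neg_le_of_abs_le h2) (le_of_abs_le h2)
    have haM : |a| ≤ M := by
      rw [hag]
      exact abs_integral_le_of_abs_le hgM
    have hsq : ∀ p q : ℝ, |p| ≤ M → |q| ≤ M → |(p - q) ^ 2| ≤ (M + M) ^ 2 := fun p q hp hq => by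
      rw [abs_pow]
      exact pow_le_pow_left₀ (abs_nonneg _) ((abs_sub _ _).trans (add_le_add hp hq)) 2
    rw [hpush _ ((hf.sub_const a).pow_const 2) ((M + M) ^ 2) fun ξ => hsq _ _ (hM ξ) haM]
    have hinner : ∀ x, ∫ ξ, (f (Fin.cons x ξ) - a) ^ 2 ∂ν ≤ (n + 1 : ℕ) * c ^ 2 := fun x => by
      have h1 : ∀ ξ : Fin n → E, (f (Fin.cons x ξ) - a) ^ 2 =
          (f (Fin.cons x ξ) - g x) ^ 2 + (2 * (g x - a) * (f (Fin.cons x ξ) - g x)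
            + (g x - a) ^ 2) := fun ξ => by ring
      have i1 : Integrable (fun ξ : Fin n → E => (f (Fin.cons x ξ) - g x) ^ 2) ν :=
        integrable_of_abs_le (C := (M + M) ^ 2) (((hfx x).sub_const _).pow_const 2) fun ξ => hsq _ _ (hM _) (hgM x)
      have i2 : Integrable (fun ξ : Fin n → E => 2 * (g x - a) * (f (Fin.cons x ξ) - g x)) ν :=
        ((hfi x).sub (integrable_const _)).const_mul _
      have i3 : ∫ ξ : Fin n → E, 2 * (g x - a) * (f (Fin.cons x ξ) - g x) ∂ν = 0 := by
        rw [integral_const_mul, integral_sub (hfi x) (integrable_const _)]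
        simp [hg]
      have i4 : Integrable (fun ξ : Fin n → E => 2 * (g x - a) * (f (Fin.cons x ξ) - g x)
          + (g x - a) ^ 2) ν := i2.add (integrable_const _)
      simp_rw [h1]
      rw [integral_add i1 i4, integral_add i2 (integrable_const _), i3]
      have h2 := ih (hfx x) (fun ξ => hM _) fun ξ i y => by
        have := hc (Fin.cons x ξ) i.succ y
        rwa [← Fin.cons_update] at this
      have h3 := hga x
      simp only [integral_const, probReal_univ, one_smul, zero_add]
      push_cast
      linarith
    calc _ ≤ ∫ _ : E, ((n + 1 : ℕ) : ℝ) * c ^ 2 ∂μ := by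
          refine integral_mono_of_nonneg (ae_of_all _ fun x => integral_nonneg fun ξ => sq_nonneg _)
            (integrable_const _) (ae_of_all _ hinner)
      _ = _ := by simp

end ProductMeasure

/-! ### Mean and variance of Gaussian quadratic forms. -/

section GaussianQuadraticForms

/-- The standard Gaussian measure on the space of vectors with `n` coordinates. -/
noncomputable abbrev stdGaussianPi (n : ℕ) : Measure (Fin n → ℝ) :=
  Measure.pi fun _ => gaussianReal 0 1

/-- The variance of the square of a standard Gaussian variable. -/
noncomputable def varianceSqGaussian : ℝ := Var[fun x => x ^ 2; gaussianReal 0 1]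

theorem holderTriple_four_four_two : ENNReal.HolderTriple 4 4 2 := ⟨by
  rw [show (4 : ENNReal) = 2 * 2 by norm_num, ENNReal.mul_inv (by simp) (by simp), ← two_mul,
    ← mul_assoc, ENNReal.mul_inv_cancel (by simp) (by simp), one_mul]⟩

theorem memLp_sq_gaussianReal : MemLp (fun x : ℝ => x ^ 2) 2 (gaussianReal 0 1) := by
  have h := memLp_id_gaussianReal' (μ := 0) (v := 1) 4 (by simp)
  have := h.mul (f := id) (hpqr := holderTriple_four_four_two) h
  simpa [Pi.mul_def, sq] using this

theorem integral_sq_gaussianReal : ∫ x, x ^ 2 ∂(gaussianReal 0 1) = 1 := by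
  have h := variance_eq_sub (memLp_id_gaussianReal' (μ := 0) (v := 1) 2 (by simp))
  rw [variance_id_gaussianReal] at h
  simpa [integral_id_gaussianReal] using h.symm

theorem trace_mul_self_eq_sum_eigenvalues {n : ℕ} {C : Matrix (Fin n) (Fin n) ℝ}
    (hC : C.IsHermitian) : (C * C).trace = ∑ i, hC.eigenvalues i ^ 2 := by
  conv_lhs => rw [hC.spectral_theorem, ← map_mul, Unitary.conjStarAlgAut_apply,
    Matrix.trace_mul_cycle]
  simp [Matrix.trace, sq]

theorem dotProduct_mulVec_sum_eigenvectorBasis {n : ℕ} {C : Matrix (Fin n) (Fin n) ℝ}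
    (hC : C.IsHermitian) (y : Fin n → ℝ) :
    (∑ i, y i • hC.eigenvectorBasis i).ofLp ⬝ᵥ C *ᵥ (∑ i, y i • hC.eigenvectorBasis i).ofLp =
      ∑ i, hC.eigenvalues i * y i ^ 2 := by
  have h1 : C *ᵥ (∑ i, y i • hC.eigenvectorBasis i).ofLp =
      (∑ i, (hC.eigenvalues i * y i) • hC.eigenvectorBasis i).ofLp := by
    simp only [WithLp.ofLp_sum, WithLp.ofLp_smul]
    rw [Matrix.mulVec_sum]
    refine Finset.sum_congr rfl fun i _ => ?_
    rw [Matrix.mulVec_smul, hC.mulVec_eigenvectorBasis, smul_smul, mul_comm]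
  have h2 : ∀ v w : EuclideanSpace ℝ (Fin n), v.ofLp ⬝ᵥ w.ofLp = inner ℝ v w := fun v w => by
    simp [PiLp.inner_apply, dotProduct, mul_comm]
  rw [h1, h2, hC.eigenvectorBasis.orthonormal.inner_sum]
  refine Finset.sum_congr rfl fun i _ => ?_
  simp
  ring

/-- Rotation invariance: the standard Gaussian has independent standard coordinates in every
orthonormal basis, in particular in an eigenbasis of `C`, where the form is diagonal. -/
theorem map_dotProduct_mulVec_stdGaussianPi {n : ℕ} {C : Matrix (Fin n) (Fin n) ℝ}
    (hC : C.IsHermitian) :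
    (stdGaussianPi n).map (fun z => z ⬝ᵥ C *ᵥ z) =
      (stdGaussianPi n).map (fun y => ∑ i, hC.eigenvalues i * y i ^ 2) := by
  have hg : Measurable fun w : EuclideanSpace ℝ (Fin n) => w.ofLp ⬝ᵥ C *ᵥ w.ofLp := by
    simp only [dotProduct, Matrix.mulVec]
    fun_prop
  have h1 : (fun z : Fin n → ℝ => z ⬝ᵥ C *ᵥ z) =
      (fun w : EuclideanSpace ℝ (Fin n) => w.ofLp ⬝ᵥ C *ᵥ w.ofLp) ∘ WithLp.toLp 2 := rfl
  have h2 : (fun y : Fin n → ℝ => ∑ i, hC.eigenvalues i * y i ^ 2) =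
      (fun w : EuclideanSpace ℝ (Fin n) => w.ofLp ⬝ᵥ C *ᵥ w.ofLp) ∘
        (fun y => ∑ i, y i • hC.eigenvectorBasis i) := by
    funext y
    exact (dotProduct_mulVec_sum_eigenvectorBasis hC y).symm
  rw [h1, h2, ← Measure.map_map hg (by fun_prop), ← Measure.map_map hg (by fun_prop),
    map_pi_eq_stdGaussian, stdGaussian_eq_map_pi_orthonormalBasis hC.eigenvectorBasis]

theorem measurable_dotProduct_mulVec {n : ℕ} (C : Matrix (Fin n) (Fin n) ℝ) :
    Measurable fun z : Fin n → ℝ => z ⬝ᵥ C *ᵥ z := by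
  simp only [dotProduct, Matrix.mulVec]
  fun_prop

theorem measurable_sum_mul_sq {n : ℕ} (c : Fin n → ℝ) :
    Measurable fun y : Fin n → ℝ => ∑ i, c i * y i ^ 2 := by
  fun_prop

theorem integral_dotProduct_mulVec_stdGaussianPi {n : ℕ} {C : Matrix (Fin n) (Fin n) ℝ}
    (hC : C.IsHermitian) : ∫ z, z ⬝ᵥ C *ᵥ z ∂(stdGaussianPi n) = C.trace := by
  have h1 : ∫ z, z ⬝ᵥ C *ᵥ z ∂(stdGaussianPi n) =
      ∫ x, x ∂((stdGaussianPi n).map (fun z => z ⬝ᵥ C *ᵥ z)) := by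
    rw [integral_map (measurable_dotProduct_mulVec C).aemeasurable (by fun_prop)]
  have hi : ∀ i, Integrable (fun y : Fin n → ℝ => y i ^ 2) (stdGaussianPi n) := fun i =>
    (measurePreserving_eval (fun _ : Fin n => gaussianReal 0 1) i).integrable_comp_of_integrable
      (memLp_sq_gaussianReal.integrable one_le_two)
  have hm : ∀ i, ∫ y : Fin n → ℝ, y i ^ 2 ∂(stdGaussianPi n) = 1 := fun i => by
    rw [← integral_sq_gaussianReal,
      ← (measurePreserving_eval (fun _ : Fin n => gaussianReal 0 1) i).map_eq, integral_map
      (measurable_pi_apply i).aemeasurable (by fun_prop)]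
  rw [h1, map_dotProduct_mulVec_stdGaussianPi hC, integral_map (measurable_sum_mul_sq _).aemeasurable
      (by fun_prop), integral_finsetSum _ fun i _ => (hi i).const_mul _, hC.trace_eq_sum_eigenvalues]
  simp [integral_const_mul, hm]

/-- After diagonalization the form is a sum of independent terms, so variances add up to a multiple
of the sum of squared eigenvalues. -/
theorem integral_sq_dotProduct_mulVec_stdGaussianPi {n : ℕ} {C : Matrix (Fin n) (Fin n) ℝ}
    (hC : C.IsHermitian) :
    ∫ z, (z ⬝ᵥ C *ᵥ z - C.trace) ^ 2 ∂(stdGaussianPi n) =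
      varianceSqGaussian * (C * C).trace := by
  have h1 : ∫ z, (z ⬝ᵥ C *ᵥ z - C.trace) ^ 2 ∂(stdGaussianPi n) =
      Var[fun z => z ⬝ᵥ C *ᵥ z; stdGaussianPi n] := by
    rw [variance_eq_integral (measurable_dotProduct_mulVec C).aemeasurable,
      integral_dotProduct_mulVec_stdGaussianPi hC]
  have hsum : (fun y : Fin n → ℝ => ∑ i, hC.eigenvalues i * y i ^ 2) =
      ∑ i, fun y : Fin n → ℝ => (fun x : ℝ => hC.eigenvalues i * x ^ 2) (y i) := by
    ext y
    simp
  rw [h1, ← variance_id_map (measurable_dotProduct_mulVec C).aemeasurable,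
    map_dotProduct_mulVec_stdGaussianPi hC, variance_id_map
      (measurable_sum_mul_sq _).aemeasurable, hsum,
    variance_sum_pi fun i => memLp_sq_gaussianReal.const_mul _,
    trace_mul_self_eq_sum_eigenvalues hC, Finset.mul_sum]
  refine Finset.sum_congr rfl fun i _ => ?_
  rw [variance_const_mul, varianceSqGaussian, mul_comm]

/-- The law `ν` has covariance `Γ`, finite fourth moments, and quadratic forms whose variance
is at most a constant multiple of that of a Gaussian vector with covariance `Γ`. -/
structure HasQuadraticMoments {d : ℕ} (ν : Measure (Fin d → ℝ)) (Γ : Matrix (Fin d) (Fin d) ℝ)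
    (κ : ℝ) : Prop where
  memLp : ∀ i, MemLp (fun x : Fin d → ℝ => x i) 4 ν
  integral_eq : ∀ B : Matrix (Fin d) (Fin d) ℝ, Bᵀ = B → ∫ x, x ⬝ᵥ B *ᵥ x ∂ν = (Γ * B).trace
  integral_sq_le : ∀ B : Matrix (Fin d) (Fin d) ℝ, Bᵀ = B →
    ∫ x, (x ⬝ᵥ B *ᵥ x - (Γ * B).trace) ^ 2 ∂ν ≤ κ * ((Γ * B) * (Γ * B)).trace

theorem varianceSqGaussian_nonneg : 0 ≤ varianceSqGaussian := variance_nonneg _ _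

theorem measurable_mulVec {d n : ℕ} (L : Matrix (Fin d) (Fin n) ℝ) :
    Measurable fun z : Fin n → ℝ => L *ᵥ z := by
  refine measurable_pi_lambda _ fun i => ?_
  simp only [Matrix.mulVec, dotProduct]
  fun_prop

/-- A quadratic form in `L z` is the form of `Lᵀ B L` in `z`; cyclicity of the trace rewrites its
moments through the covariance `L Lᵀ`. -/
theorem hasQuadraticMoments_map_stdGaussianPi {d n : ℕ} (L : Matrix (Fin d) (Fin n) ℝ) :
    HasQuadraticMoments ((stdGaussianPi n).map (L *ᵥ ·)) (L * Lᵀ) varianceSqGaussian := by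
  have hL := measurable_mulVec L
  have hq : ∀ (B : Matrix (Fin d) (Fin d) ℝ) (z : Fin n → ℝ),
      (L *ᵥ z) ⬝ᵥ B *ᵥ (L *ᵥ z) = z ⬝ᵥ (Lᵀ * B * L) *ᵥ z := fun B z => by
    rw [← Matrix.mulVec_mulVec, ← Matrix.mulVec_mulVec, Matrix.dotProduct_mulVec z,
      Matrix.vecMul_transpose]
  have hH : ∀ B : Matrix (Fin d) (Fin d) ℝ, Bᵀ = B → (Lᵀ * B * L).IsHermitian := fun B hB => by
    rw [Matrix.IsHermitian, Matrix.conjTranspose_eq_transpose_of_trivial]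
    simp [Matrix.transpose_mul, hB, Matrix.mul_assoc]
  have htr : ∀ B : Matrix (Fin d) (Fin d) ℝ, (Lᵀ * B * L).trace = (L * Lᵀ * B).trace := fun B => by
    rw [Matrix.trace_mul_cycle]
  refine ⟨fun i => ?_, fun B hB => ?_, fun B hB => ?_⟩
  · have h4 : ∀ j, MemLp (fun z : Fin n → ℝ => z j) 4 (stdGaussianPi n) := fun j =>
      (memLp_id_gaussianReal' (μ := 0) (v := 1) 4 (by simp)).comp_measurePreserving
        (measurePreserving_eval (fun _ : Fin n => gaussianReal 0 1) j)
    rw [memLp_map_measure_iff (measurable_pi_apply i).aestronglyMeasurable hL.aemeasurable]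
    have : ((fun x : Fin d → ℝ => x i) ∘ fun z : Fin n → ℝ => L *ᵥ z) =
        fun z => ∑ j, L i j * z j := by
      ext z
      simp [Matrix.mulVec, dotProduct]
    rw [this]
    exact memLp_finsetSum _ fun j _ => (h4 j).const_mul _
  · rw [integral_map hL.aemeasurable (measurable_dotProduct_mulVec B).aestronglyMeasurable]
    simp_rw [hq]
    rw [integral_dotProduct_mulVec_stdGaussianPi (hH B hB), htr]
  · rw [integral_map hL.aemeasurable
      (((measurable_dotProduct_mulVec B).sub_const _).pow_const 2).aestronglyMeasurable]
    simp_rw [hq, ← htr]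
    rw [integral_sq_dotProduct_mulVec_stdGaussianPi (hH B hB)]
    have : (Lᵀ * B * L * (Lᵀ * B * L)).trace = ((L * Lᵀ * B) * (L * Lᵀ * B)).trace := by
      rw [show Lᵀ * B * L * (Lᵀ * B * L) = Lᵀ * B * (L * Lᵀ * B) * L by
        simp only [Matrix.mul_assoc], Matrix.trace_mul_comm]
      simp only [Matrix.mul_assoc]
    rw [this]

end GaussianQuadraticForms

/-! ### Positivity of traces of products. -/

section TraceNonneg

open scoped MatrixOrder

variable {d : ℕ} {lam : ℝ} {K : Matrix (Fin d) (Fin d) ℝ}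

theorem posSemidef_resolvent (hlam : 0 < lam) (hK : K.PosSemidef) :
    ((K + lam • (1 : Matrix (Fin d) (Fin d) ℝ))⁻¹).PosSemidef :=
  (Matrix.PosDef.posSemidef_add hK (Matrix.PosDef.one.smul hlam)).inv.posSemidef

/-- Factor `B = X* X` and cycle the trace to that of the positive semidefinite matrix `X C X*`. -/
theorem trace_mul_nonneg_of_posSemidef {B C : Matrix (Fin d) (Fin d) ℝ} (hB : B.PosSemidef)
    (hC : C.PosSemidef) : 0 ≤ (B * C).trace := by
  obtain ⟨X, rfl⟩ := CStarAlgebra.nonneg_iff_eq_star_mul_self.mp hB.nonneg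
  rw [Matrix.star_eq_conjTranspose]
  rw [Matrix.mul_assoc, Matrix.trace_mul_comm]
  exact (hC.mul_mul_conjTranspose_same X).trace_nonneg

theorem trace_mul_vecMulVec (B : Matrix (Fin d) (Fin d) ℝ) (u v : Fin d → ℝ) :
    (B * Matrix.vecMulVec u v).trace = v ⬝ᵥ B *ᵥ u := by
  rw [Matrix.mul_vecMulVec, Matrix.trace_vecMulVec, dotProduct_comm]

end TraceNonneg

/-! ### Moment bounds for linear and quadratic forms of one sample vector. -/

section Moments

variable {d : ℕ} {ν : Measure (Fin d → ℝ)}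
  {Γ : Matrix (Fin d) (Fin d) ℝ} {κ : ℝ}

theorem HasQuadraticMoments.memLp_dotProduct_mulVec (h : HasQuadraticMoments ν Γ κ)
    (B : Matrix (Fin d) (Fin d) ℝ) : MemLp (fun x => x ⬝ᵥ B *ᵥ x) 2 ν := by
  have hij : ∀ i j, MemLp (fun x : Fin d → ℝ => x i * x j) 2 ν := fun i j =>
    MemLp.mul' (hpqr := holderTriple_four_four_two) (h.memLp j) (h.memLp i)
  have : (fun x : Fin d → ℝ => x ⬝ᵥ B *ᵥ x) = fun x => ∑ i, ∑ j, B i j * (x i * x j) := by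
    ext x
    simp only [dotProduct, Matrix.mulVec, Finset.mul_sum]
    exact Finset.sum_congr rfl fun i _ => Finset.sum_congr rfl fun j _ => by ring
  rw [this]
  exact memLp_finsetSum _ fun i _ => memLp_finsetSum _ fun j _ => (hij i j).const_mul _

theorem HasQuadraticMoments.integral_dotProduct_mul_dotProduct (h : HasQuadraticMoments ν Γ κ)
    (hΓ : Γᵀ = Γ) (u v : Fin d → ℝ) :
    ∫ x, (u ⬝ᵥ x) * (x ⬝ᵥ v) ∂ν = u ⬝ᵥ Γ *ᵥ v := by
  -- The moment hypothesis covers symmetric matrices only, so `u vᵀ` is replaced by its symmetric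
  -- part.
  have hq : ∀ x : Fin d → ℝ, (u ⬝ᵥ x) * (x ⬝ᵥ v) =
      x ⬝ᵥ ((2⁻¹ : ℝ) • (Matrix.vecMulVec u v + Matrix.vecMulVec v u)) *ᵥ x := fun x => by
    rw [Matrix.smul_mulVec, Matrix.add_mulVec, Matrix.vecMulVec_mulVec, Matrix.vecMulVec_mulVec,
      op_smul_eq_smul, op_smul_eq_smul, dotProduct_smul, dotProduct_add, dotProduct_smul,
      dotProduct_smul, dotProduct_comm x u, dotProduct_comm v x]
    simp only [smul_eq_mul]
    ring
  simp_rw [hq]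
  rw [h.integral_eq]
  · rw [Matrix.mul_smul, Matrix.trace_smul, Matrix.mul_add, Matrix.trace_add, trace_mul_vecMulVec,
      trace_mul_vecMulVec, dotProduct_mulVec_comm_of_transpose_eq hΓ v u,
      dotProduct_comm _ u, smul_eq_mul]
    ring
  · rw [Matrix.transpose_smul, Matrix.transpose_add, Matrix.transpose_vecMulVec,
      Matrix.transpose_vecMulVec, add_comm]

theorem HasQuadraticMoments.integral_dotProduct_sq_le (h : HasQuadraticMoments ν Γ κ)
    (hΓ : Γᵀ = Γ) (u : Fin d → ℝ) :
    ∫ x, (u ⬝ᵥ x) ^ 2 ∂ν ≤ ‖Γ‖ * (u ⬝ᵥ u) := by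
  have := h.integral_dotProduct_mul_dotProduct hΓ u u
  simp_rw [fun x : Fin d → ℝ => dotProduct_comm x u, ← sq] at this
  rw [this]
  exact dotProduct_mulVec_self_le Γ u

/-- For `B = u uᵀ` the quadratic form is `(u ⬝ᵥ x)²`, with mean `q = u ⬝ᵥ Γ u` and variance at most
`κ q²`; then use `p² ≤ 2 (p - q)² + 2 q²`. -/
theorem HasQuadraticMoments.integral_dotProduct_pow_four_le [IsProbabilityMeasure ν]
    (h : HasQuadraticMoments ν Γ κ)
    (hκ : 0 ≤ κ) (hΓ : Γ.PosSemidef) (u : Fin d → ℝ) :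
    ∫ x, (u ⬝ᵥ x) ^ 4 ∂ν ≤ (2 * κ + 2) * (‖Γ‖ * (u ⬝ᵥ u)) ^ 2 := by
  set B := Matrix.vecMulVec u u with hB
  have hBt : Bᵀ = B := Matrix.transpose_vecMulVec u u
  have hq : ∀ x : Fin d → ℝ, x ⬝ᵥ B *ᵥ x = (u ⬝ᵥ x) ^ 2 := fun x => by
    rw [hB, Matrix.vecMulVec_mulVec, op_smul_eq_smul, dotProduct_smul, dotProduct_comm x u,
      smul_eq_mul, sq]
  have htr : (Γ * B).trace = u ⬝ᵥ Γ *ᵥ u := trace_mul_vecMulVec Γ u u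
  have htr2 : ((Γ * B) * (Γ * B)).trace = (u ⬝ᵥ Γ *ᵥ u) ^ 2 := by
    rw [hB, Matrix.mul_vecMulVec, Matrix.vecMulVec_mul_vecMulVec, Matrix.trace_vecMulVec,
      dotProduct_smul, dotProduct_comm (Γ *ᵥ u), smul_eq_mul, sq]
  have h0 := dotProduct_mulVec_nonneg hΓ u
  have h1 := h.integral_sq_le B hBt
  rw [htr2, htr] at h1
  have hL := h.memLp_dotProduct_mulVec B
  have hsub : Integrable (fun x => (x ⬝ᵥ B *ᵥ x - u ⬝ᵥ Γ *ᵥ u) ^ 2) ν :=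
    (hL.sub (memLp_const (u ⬝ᵥ Γ *ᵥ u))).integrable_sq
  have h2 : ∫ x, (u ⬝ᵥ x) ^ 4 ∂ν ≤
      ∫ x, (2 * (x ⬝ᵥ B *ᵥ x - u ⬝ᵥ Γ *ᵥ u) ^ 2 + 2 * (u ⬝ᵥ Γ *ᵥ u) ^ 2) ∂ν := by
    refine integral_mono ?_ ((hsub.const_mul 2).add (integrable_const _)) fun x => ?_
    · have := hL.integrable_sq
      simp_rw [hq, ← pow_mul] at this
      exact this
    · have := hq x
      simp only
      rw [show (u ⬝ᵥ x) ^ 4 = (x ⬝ᵥ B *ᵥ x) ^ 2 by rw [this]; ring]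
      nlinarith [sq_nonneg (x ⬝ᵥ B *ᵥ x - 2 * (u ⬝ᵥ Γ *ᵥ u))]
  rw [integral_add (hsub.const_mul 2) (integrable_const _), integral_const_mul, integral_const,
    probReal_univ, one_smul] at h2
  have h3 : (u ⬝ᵥ Γ *ᵥ u) ^ 2 ≤ (‖Γ‖ * (u ⬝ᵥ u)) ^ 2 :=
    pow_le_pow_left₀ h0 (dotProduct_mulVec_self_le Γ u) 2
  nlinarith [mul_le_mul_of_nonneg_left h3 hκ]

/-- The variance is linear, not quadratic, in `d`: with the factor `t² = O(m⁻²)` and `d ≤ m` it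
becomes `O(1/m)`. -/
theorem HasQuadraticMoments.integral_sq_le_norm (h : HasQuadraticMoments ν Γ κ) (hκ : 0 ≤ κ)
    {B : Matrix (Fin d) (Fin d) ℝ} (hB : Bᵀ = B) :
    ∫ x, (x ⬝ᵥ B *ᵥ x - (Γ * B).trace) ^ 2 ∂ν ≤ κ * (d * (‖Γ‖ * ‖B‖) ^ 2) := by
  refine (h.integral_sq_le B hB).trans (mul_le_mul_of_nonneg_left ?_ hκ)
  refine (le_abs_self _).trans ((abs_trace_le _).trans ?_)
  gcongr
  calc ‖Γ * B * (Γ * B)‖ ≤ ‖Γ * B‖ * ‖Γ * B‖ := norm_mul_le _ _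
    _ ≤ (‖Γ‖ * ‖B‖) * (‖Γ‖ * ‖B‖) := by gcongr <;> exact norm_mul_le _ _
    _ = _ := by ring

end Moments

/-! ### Sample covariance resolvents and leave-one-out identities. -/

section SampleResolvent

variable {m d : ℕ}

/-- The weighted sample covariance `t ∑ ξᵢ ξᵢᵀ`. -/
def sampleCov (t : ℝ) (ξ : Fin m → Fin d → ℝ) : Matrix (Fin d) (Fin d) ℝ :=
  t • ∑ i, Matrix.vecMulVec (ξ i) (ξ i)

/-- The resolvent `(t ∑ ξᵢ ξᵢᵀ + lam I)⁻¹`. -/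
noncomputable def sampleResolvent (lam t : ℝ) (ξ : Fin m → Fin d → ℝ) :
    Matrix (Fin d) (Fin d) ℝ :=
  (sampleCov t ξ + lam • (1 : Matrix (Fin d) (Fin d) ℝ))⁻¹

variable {lam t : ℝ}

theorem posSemidef_sampleCov (ht : 0 ≤ t) (ξ : Fin m → Fin d → ℝ) :
    (sampleCov t ξ).PosSemidef := by
  refine Matrix.PosSemidef.smul (Matrix.posSemidef_sum _ fun i _ => ?_) ht
  simpa using Matrix.posSemidef_vecMulVec_self_star (ξ i)

/-- Setting a vector to zero plays the role of deleting it, which keeps the index type `Fin m` and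
the weight `t` unchanged. -/
theorem sampleCov_eq_update_add (ξ : Fin m → Fin d → ℝ) (i : Fin m) :
    sampleCov t ξ = sampleCov t (Function.update ξ i 0) + t • Matrix.vecMulVec (ξ i) (ξ i) := by
  rw [sampleCov, sampleCov, ← smul_add, ← Finset.add_sum_erase _ _ (Finset.mem_univ i),
    ← Finset.add_sum_erase (a := i) _
      (fun j => Matrix.vecMulVec (Function.update ξ i 0 j) (Function.update ξ i 0 j))
      (Finset.mem_univ i), add_comm]
  congr 2
  simp only [Function.update_self, Matrix.vecMulVec_zero, zero_add]
  refine Finset.sum_congr rfl fun j hj => ?_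
  rw [Function.update_of_ne (Finset.ne_of_mem_erase hj)]

theorem norm_sampleResolvent_le (hlam : 0 < lam) (ht : 0 ≤ t) (ξ : Fin m → Fin d → ℝ) :
    ‖sampleResolvent lam t ξ‖ ≤ lam⁻¹ :=
  norm_resolvent_le hlam (posSemidef_sampleCov ht ξ)

theorem transpose_sampleResolvent (ht : 0 ≤ t) (ξ : Fin m → Fin d → ℝ) :
    (sampleResolvent lam t ξ)ᵀ = sampleResolvent lam t ξ :=
  transpose_resolvent (posSemidef_sampleCov ht ξ)

theorem continuous_sampleCov_add (lam t : ℝ) :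
    Continuous fun ξ : Fin m → Fin d → ℝ =>
      sampleCov t ξ + lam • (1 : Matrix (Fin d) (Fin d) ℝ) := by
  refine continuous_pi fun a => continuous_pi fun b => ?_
  simp only [sampleCov, Matrix.add_apply, Matrix.smul_apply, Matrix.sum_apply,
    Matrix.vecMulVec_apply]
  fun_prop

theorem continuous_sampleResolvent (hlam : 0 < lam) (ht : 0 ≤ t) :
    Continuous fun ξ : Fin m → Fin d → ℝ => sampleResolvent lam t ξ := by
  have h := continuous_sampleCov_add (m := m) (d := d) lam t
  -- The adjugate formula makes continuity evident, since the determinant never vanishes.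
  have : (fun ξ : Fin m → Fin d → ℝ => sampleResolvent lam t ξ) = fun ξ =>
      (sampleCov t ξ + lam • (1 : Matrix (Fin d) (Fin d) ℝ)).det⁻¹ •
        (sampleCov t ξ + lam • (1 : Matrix (Fin d) (Fin d) ℝ)).adjugate := by
    funext ξ
    rw [sampleResolvent, Matrix.inv_def, Ring.inverse_eq_inv']
  rw [this]
  exact (h.matrix_det.inv₀ fun ξ =>
    (isUnit_det_add_smul_one hlam (posSemidef_sampleCov ht ξ)).ne_zero).smul h.matrix_adjugate

/-- The leave-one-out denominator `1 + t xᵀ R x`, with `R` the resolvent without the vector `x`. -/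
noncomputable def looDenom (lam t : ℝ) (ξ : Fin m → Fin d → ℝ) (i : Fin m) : ℝ :=
  1 + t * (ξ i ⬝ᵥ sampleResolvent lam t (Function.update ξ i 0) *ᵥ ξ i)

theorem one_le_looDenom (hlam : 0 < lam) (ht : 0 ≤ t) (ξ : Fin m → Fin d → ℝ) (i : Fin m) :
    1 ≤ looDenom lam t ξ i := by
  have := mul_nonneg ht (dotProduct_resolvent_nonneg hlam
    (posSemidef_sampleCov ht (Function.update ξ i 0)) (ξ i))
  rw [looDenom, sampleResolvent]
  linarith

theorem sampleResolvent_update_mulVec (hlam : 0 < lam) (ht : 0 ≤ t) (ξ : Fin m → Fin d → ℝ)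
    (i : Fin m) :
    sampleResolvent lam t (Function.update ξ i 0) *ᵥ ξ i =
      looDenom lam t ξ i • sampleResolvent lam t ξ *ᵥ ξ i := by
  rw [looDenom, sampleResolvent, sampleResolvent, sampleCov_eq_update_add ξ i]
  exact resolvent_mulVec_eq_smul hlam (posSemidef_sampleCov ht _) ht (ξ i)

theorem sampleResolvent_mulVec (hlam : 0 < lam) (ht : 0 ≤ t) (ξ : Fin m → Fin d → ℝ)
    (i : Fin m) :
    sampleResolvent lam t ξ *ᵥ ξ i = (looDenom lam t ξ i)⁻¹ •
      sampleResolvent lam t (Function.update ξ i 0) *ᵥ ξ i := by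
  rw [sampleResolvent_update_mulVec hlam ht, smul_smul, inv_mul_cancel₀, one_smul]
  linarith [one_le_looDenom hlam ht ξ i]

theorem sampleResolvent_update_sub (hlam : 0 < lam) (ht : 0 ≤ t) (ξ : Fin m → Fin d → ℝ)
    (i : Fin m) :
    sampleResolvent lam t (Function.update ξ i 0) - sampleResolvent lam t ξ =
      (t * (looDenom lam t ξ i)⁻¹) • Matrix.vecMulVec
        (sampleResolvent lam t (Function.update ξ i 0) *ᵥ ξ i)
        (sampleResolvent lam t (Function.update ξ i 0) *ᵥ ξ i) := by
  have h := resolvent_sub_resolvent_add_vecMulVec hlam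
    (posSemidef_sampleCov ht (Function.update ξ i 0)) ht (ξ i)
  rw [← sampleCov_eq_update_add] at h
  change sampleResolvent lam t (Function.update ξ i 0) - sampleResolvent lam t ξ =
    t • Matrix.vecMulVec (sampleResolvent lam t ξ *ᵥ ξ i)
      (sampleResolvent lam t (Function.update ξ i 0) *ᵥ ξ i) at h
  rw [h, sampleResolvent_mulVec hlam ht, Matrix.smul_vecMulVec, smul_smul]

/-- Removing one vector increases `tr (Γ R)`, by a bounded amount. -/
theorem trace_mul_sampleResolvent_update_sub (hlam : 0 < lam) (ht : 0 ≤ t)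
    {Γ : Matrix (Fin d) (Fin d) ℝ} (hΓ : Γ.PosSemidef) (ξ : Fin m → Fin d → ℝ) (i : Fin m) :
    (Γ * sampleResolvent lam t (Function.update ξ i 0)).trace -
      (Γ * sampleResolvent lam t ξ).trace ∈ Set.Icc 0 (‖Γ‖ * lam⁻¹) := by
  rw [← Matrix.trace_sub, ← Matrix.mul_sub, sampleResolvent_update_sub hlam ht, Matrix.mul_smul,
    Matrix.trace_smul, trace_mul_vecMulVec, smul_eq_mul]
  have hq := one_le_looDenom hlam ht ξ i
  have h1 := mul_resolvent_dotProduct_self_le hlam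
    (posSemidef_sampleCov ht (Function.update ξ i 0)) (ξ i)
  rw [← sampleResolvent] at h1
  set w := sampleResolvent lam t (Function.update ξ i 0) *ᵥ ξ i with hw
  -- This cancels the denominator: `|w|² ≤ lam⁻¹ (ξ i ⬝ᵥ w)` leaves only this product, and the bound
  -- depends on neither `ξ` nor `d`.
  have h2 : t * (ξ i ⬝ᵥ w) ≤ looDenom lam t ξ i := by rw [looDenom]; linarith
  have h3 := dotProduct_mulVec_self_le Γ w
  have h4 := dotProduct_mulVec_nonneg hΓ w
  have hq0 : 0 < looDenom lam t ξ i := by linarith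
  refine ⟨by positivity, ?_⟩
  rw [mul_assoc, ← div_eq_inv_mul, ← mul_div_assoc, div_le_iff₀ hq0]
  calc t * (w ⬝ᵥ Γ *ᵥ w) ≤ t * (‖Γ‖ * (lam⁻¹ * (ξ i ⬝ᵥ w))) := by
        gcongr
        refine h3.trans ?_
        gcongr
        rwa [← div_eq_inv_mul, le_div_iff₀' hlam]
    _ = ‖Γ‖ * lam⁻¹ * (t * (ξ i ⬝ᵥ w)) := by ring
    _ ≤ _ := by gcongr

/-- Both traces lie below the trace with the vector removed, by at most the same amount, so no
factor 2 appears. This is the bounded difference used for the variance. -/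
theorem abs_trace_mul_sampleResolvent_sub_update_le (hlam : 0 < lam) (ht : 0 ≤ t)
    {Γ : Matrix (Fin d) (Fin d) ℝ} (hΓ : Γ.PosSemidef) (ξ : Fin m → Fin d → ℝ) (i : Fin m)
    (y : Fin d → ℝ) :
    |(Γ * sampleResolvent lam t ξ).trace -
      (Γ * sampleResolvent lam t (Function.update ξ i y)).trace| ≤ ‖Γ‖ * lam⁻¹ := by
  have h1 := trace_mul_sampleResolvent_update_sub hlam ht hΓ ξ i
  have h2 := trace_mul_sampleResolvent_update_sub hlam ht hΓ (Function.update ξ i y) i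
  rw [Function.update_idem] at h2
  rw [abs_le]
  constructor <;> linarith [h1.1, h1.2, h2.1, h2.2]

theorem abs_dotProduct_sampleResolvent_update_sub_le (hlam : 0 < lam) (ht : 0 ≤ t)
    (ξ : Fin m → Fin d → ℝ) (i : Fin m) (u v : Fin d → ℝ) :
    |u ⬝ᵥ sampleResolvent lam t (Function.update ξ i 0) *ᵥ v -
      u ⬝ᵥ sampleResolvent lam t ξ *ᵥ v| ≤
      t / 2 * (((sampleResolvent lam t (Function.update ξ i 0) *ᵥ u) ⬝ᵥ ξ i) ^ 2 +
        ((sampleResolvent lam t (Function.update ξ i 0) *ᵥ v) ⬝ᵥ ξ i) ^ 2) := by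
  have hs := transpose_sampleResolvent (lam := lam) ht (Function.update ξ i 0)
  rw [← dotProduct_sub, ← Matrix.sub_mulVec, sampleResolvent_update_sub hlam ht,
    Matrix.smul_mulVec, Matrix.vecMulVec_mulVec, op_smul_eq_smul, dotProduct_smul, dotProduct_smul,
    dotProduct_mulVec_comm_of_transpose_eq hs u, dotProduct_comm _ v,
    dotProduct_mulVec_comm_of_transpose_eq hs v, smul_eq_mul, smul_eq_mul]
  set p := (sampleResolvent lam t (Function.update ξ i 0) *ᵥ u) ⬝ᵥ ξ i
  set r := (sampleResolvent lam t (Function.update ξ i 0) *ᵥ v) ⬝ᵥ ξ i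
  have hq := one_le_looDenom hlam ht ξ i
  have hq1 : (looDenom lam t ξ i)⁻¹ ≤ 1 := inv_le_one_of_one_le₀ hq
  have hq0 : 0 ≤ (looDenom lam t ξ i)⁻¹ := by positivity
  rw [abs_mul, abs_of_nonneg (mul_nonneg ht hq0)]
  calc t * (looDenom lam t ξ i)⁻¹ * |r * p| ≤ t * 1 * ((p ^ 2 + r ^ 2) / 2) := by
        gcongr
        rw [abs_mul]
        nlinarith [sq_nonneg (|r| - |p|), sq_abs r, sq_abs p]
    _ = _ := by ring

/-- The exact leave-one-out expansion of the identity `R (t ∑ ξᵢ ξᵢᵀ + lam I) = I`. -/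
theorem dotProduct_eq_sampleResolvent_add_sum (hlam : 0 < lam) (ht : 0 ≤ t)
    (ξ : Fin m → Fin d → ℝ) (u v : Fin d → ℝ) :
    u ⬝ᵥ v = lam * (u ⬝ᵥ sampleResolvent lam t ξ *ᵥ v) +
      t * ∑ i, ((sampleResolvent lam t (Function.update ξ i 0) *ᵥ u) ⬝ᵥ ξ i) * (ξ i ⬝ᵥ v) *
        (looDenom lam t ξ i)⁻¹ := by
  have h1 : sampleResolvent lam t ξ *ᵥ ((sampleCov t ξ + lam • 1) *ᵥ v) = v := by
    rw [Matrix.mulVec_mulVec, sampleResolvent, resolvent_mul hlam (posSemidef_sampleCov ht ξ),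
      Matrix.one_mulVec]
  have h2 : (sampleCov t ξ + lam • 1) *ᵥ v = t • ∑ i, (ξ i ⬝ᵥ v) • ξ i + lam • v := by
    rw [Matrix.add_mulVec, Matrix.smul_mulVec, Matrix.one_mulVec, sampleCov, Matrix.smul_mulVec,
      Matrix.sum_mulVec]
    simp only [Matrix.vecMulVec_mulVec, op_smul_eq_smul]
  conv_lhs => rw [← h1, h2]
  rw [Matrix.mulVec_add, Matrix.mulVec_smul, Matrix.mulVec_smul, Matrix.mulVec_sum, dotProduct_add,
    dotProduct_smul, dotProduct_smul, dotProduct_sum, smul_eq_mul, smul_eq_mul, add_comm]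
  congr 2
  refine Finset.sum_congr rfl fun i _ => ?_
  rw [Matrix.mulVec_smul, sampleResolvent_mulVec hlam ht, dotProduct_smul, dotProduct_smul,
    dotProduct_mulVec_comm_of_transpose_eq (transpose_sampleResolvent ht _), smul_eq_mul,
    smul_eq_mul]
  ring

end SampleResolvent

/-! ### Integration over one vector, conditionally on the others. -/

section LeaveOneOut

variable {m d : ℕ} {ν : Measure (Fin d → ℝ)} [IsProbabilityMeasure ν]
  {Γ : Matrix (Fin d) (Fin d) ℝ} {κ lam t : ℝ}

/-- Resampling coordinate `i` leaves `Function.update ξ i 0` untouched: this expresses the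
independence of `ξ i` from the leave-one-out data. -/
theorem integral_eq_integral_integral_update_zero (i : Fin m)
    (G : (Fin m → Fin d → ℝ) → (Fin d → ℝ) → ℝ)
    (hG : Integrable (fun ξ : Fin m → Fin d → ℝ => G (Function.update ξ i 0) (ξ i))
      (Measure.pi fun _ => ν)) :
    ∫ ξ, G (Function.update ξ i 0) (ξ i) ∂(Measure.pi fun _ => ν) =
      ∫ ξ, ∫ x, G (Function.update ξ i 0) x ∂ν ∂(Measure.pi fun _ => ν) := by
  rw [integral_pi_eq_integral_integral_update i hG]
  simp

theorem integral_update_zero_le (i : Fin m)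
    (G : (Fin m → Fin d → ℝ) → (Fin d → ℝ) → ℝ) {C : ℝ}
    (hG : Integrable (fun ξ : Fin m → Fin d → ℝ => G (Function.update ξ i 0) (ξ i))
      (Measure.pi fun _ => ν))
    (h0 : ∀ η x, 0 ≤ G η x) (hC : ∀ η, ∫ x, G η x ∂ν ≤ C) :
    ∫ ξ, G (Function.update ξ i 0) (ξ i) ∂(Measure.pi fun _ => ν) ≤ C := by
  rw [integral_eq_integral_integral_update_zero i G hG]
  refine (integral_mono_of_nonneg (ae_of_all _ fun ξ => integral_nonneg fun x => h0 _ _)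
    (integrable_const C) (ae_of_all _ fun ξ => hC _)).trans ?_
  simp

theorem HasQuadraticMoments.integrable_of_abs_le (h : HasQuadraticMoments ν Γ κ) (i : Fin m)
    {g : (Fin m → Fin d → ℝ) → ℝ} (hg : Continuous g) {C : ℝ}
    (hC : ∀ ξ, |g ξ| ≤ C * (1 + (ξ i ⬝ᵥ ξ i) ^ 2)) :
    Integrable g (Measure.pi fun _ => ν) := by
  have h1 : Integrable (fun x : Fin d → ℝ => C * (1 + (x ⬝ᵥ x) ^ 2)) ν := by
    have := (h.memLp_dotProduct_mulVec 1).integrable_sq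
    simp only [Matrix.one_mulVec] at this
    exact ((integrable_const 1).add this).const_mul C
  have h2 := (measurePreserving_eval (fun _ : Fin m => ν) i).integrable_comp_of_integrable h1
  exact h2.mono' hg.measurable.aestronglyMeasurable (ae_of_all _ hC)

theorem dotProduct_sq_le (w x : Fin d → ℝ) : (w ⬝ᵥ x) ^ 2 ≤ (w ⬝ᵥ w) * (x ⬝ᵥ x) := by
  rw [← norm_toLp_sq, ← norm_toLp_sq, ← mul_pow, ← sq_abs]
  exact pow_le_pow_left₀ (abs_nonneg _) (abs_dotProduct_le _ _) 2

theorem zero_le_dotProduct_self (x : Fin d → ℝ) : 0 ≤ x ⬝ᵥ x := by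
  rw [← norm_toLp_sq]
  positivity

theorem continuous_update_zero (i : Fin m) :
    Continuous fun ξ : Fin m → Fin d → ℝ => Function.update ξ i 0 :=
  continuous_id.update i continuous_const

variable {i : Fin m} {W : (Fin m → Fin d → ℝ) → Fin d → ℝ} {c : ℝ}

theorem HasQuadraticMoments.integrable_loo_pow_four (h : HasQuadraticMoments ν Γ κ)
    (hW : Continuous W) (hc : ∀ ξ, W ξ ⬝ᵥ W ξ ≤ c) :
    Integrable (fun ξ => (W (Function.update ξ i 0) ⬝ᵥ ξ i) ^ 4) (Measure.pi fun _ => ν) := by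
  have hcont : Continuous fun ξ => (W (Function.update ξ i 0) ⬝ᵥ ξ i) ^ 4 :=
    ((hW.comp (continuous_update_zero i)).dotProduct (continuous_apply i)).pow 4
  refine h.integrable_of_abs_le i hcont (C := c ^ 2) fun ξ => ?_
  have h1 := dotProduct_sq_le (W (Function.update ξ i 0)) (ξ i)
  have h2 := hc (Function.update ξ i 0)
  have h3 := zero_le_dotProduct_self (ξ i)
  have h4 : (W (Function.update ξ i 0) ⬝ᵥ ξ i) ^ 2 ≤ c * (ξ i ⬝ᵥ ξ i) :=
    h1.trans (mul_le_mul_of_nonneg_right h2 h3)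
  rw [abs_of_nonneg (by positivity)]
  calc (W (Function.update ξ i 0) ⬝ᵥ ξ i) ^ 4 = ((W (Function.update ξ i 0) ⬝ᵥ ξ i) ^ 2) ^ 2 := by
        ring
    _ ≤ (c * (ξ i ⬝ᵥ ξ i)) ^ 2 := pow_le_pow_left₀ (sq_nonneg _) h4 2
    _ ≤ _ := by nlinarith [sq_nonneg c]

theorem HasQuadraticMoments.integrable_loo_sq (h : HasQuadraticMoments ν Γ κ)
    (hW : Continuous W) (hc : ∀ ξ, W ξ ⬝ᵥ W ξ ≤ c) :
    Integrable (fun ξ => (W (Function.update ξ i 0) ⬝ᵥ ξ i) ^ 2) (Measure.pi fun _ => ν) := by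
  have hcont : Continuous fun ξ => (W (Function.update ξ i 0) ⬝ᵥ ξ i) ^ 2 :=
    ((hW.comp (continuous_update_zero i)).dotProduct (continuous_apply i)).pow 2
  refine ((integrable_const 1).add (h.integrable_loo_pow_four (i := i) hW hc)).mono'
    hcont.measurable.aestronglyMeasurable (ae_of_all _ fun ξ => ?_)
  simp only [Pi.add_apply]
  rw [Real.norm_of_nonneg (sq_nonneg _)]
  nlinarith [sq_nonneg ((W (Function.update ξ i 0) ⬝ᵥ ξ i) ^ 2 - 1)]

theorem HasQuadraticMoments.integral_loo_pow_four_le (h : HasQuadraticMoments ν Γ κ)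
    (hκ : 0 ≤ κ) (hΓ : Γ.PosSemidef) (hW : Continuous W) (hc : ∀ ξ, W ξ ⬝ᵥ W ξ ≤ c) :
    ∫ ξ, (W (Function.update ξ i 0) ⬝ᵥ ξ i) ^ 4 ∂(Measure.pi fun _ => ν) ≤
      (2 * κ + 2) * (‖Γ‖ * c) ^ 2 := by
  refine integral_update_zero_le i (fun η x => (W η ⬝ᵥ x) ^ 4) (h.integrable_loo_pow_four hW hc)
    (fun η x => by positivity) fun η => ?_
  refine (h.integral_dotProduct_pow_four_le hκ hΓ (W η)).trans ?_
  have := zero_le_dotProduct_self (W η)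
  have := hc η
  gcongr

theorem HasQuadraticMoments.integral_loo_sq_le (h : HasQuadraticMoments ν Γ κ)
    (hΓ : Γ.PosSemidef) (hW : Continuous W) (hc : ∀ ξ, W ξ ⬝ᵥ W ξ ≤ c) :
    ∫ ξ, (W (Function.update ξ i 0) ⬝ᵥ ξ i) ^ 2 ∂(Measure.pi fun _ => ν) ≤ ‖Γ‖ * c := by
  refine integral_update_zero_le i (fun η x => (W η ⬝ᵥ x) ^ 2) (h.integrable_loo_sq hW hc)
    (fun η x => by positivity) fun η => ?_
  refine (h.integral_dotProduct_sq_le (transpose_eq_of_posSemidef hΓ) (W η)).trans ?_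
  have := hc η
  gcongr

theorem HasQuadraticMoments.integrable_loo_mul (h : HasQuadraticMoments ν Γ κ)
    (hW : Continuous W) (hc : ∀ ξ, W ξ ⬝ᵥ W ξ ≤ c) (v : Fin d → ℝ) :
    Integrable (fun ξ => (W (Function.update ξ i 0) ⬝ᵥ ξ i) * (ξ i ⬝ᵥ v))
      (Measure.pi fun _ => ν) := by
  have hcont : Continuous fun ξ => (W (Function.update ξ i 0) ⬝ᵥ ξ i) * (ξ i ⬝ᵥ v) :=
    ((hW.comp (continuous_update_zero i)).dotProduct (continuous_apply i)).mul
      ((continuous_apply i).dotProduct continuous_const)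
  refine ((h.integrable_loo_sq (i := i) hW hc).add (h.integrable_loo_sq (i := i) (W := fun _ => v)
    continuous_const fun _ => le_rfl)).mono'
    hcont.measurable.aestronglyMeasurable (ae_of_all _ fun ξ => ?_)
  simp only [Pi.add_apply]
  rw [dotProduct_comm (ξ i) v, Real.norm_eq_abs, abs_le]
  constructor <;> nlinarith [sq_nonneg (W (Function.update ξ i 0) ⬝ᵥ ξ i + v ⬝ᵥ ξ i),
    sq_nonneg (W (Function.update ξ i 0) ⬝ᵥ ξ i - v ⬝ᵥ ξ i)]

theorem HasQuadraticMoments.integral_loo_mul (h : HasQuadraticMoments ν Γ κ)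
    (hΓ : Γ.PosSemidef) (hW : Continuous W) (hc : ∀ ξ, W ξ ⬝ᵥ W ξ ≤ c) (v : Fin d → ℝ) :
    ∫ ξ, (W (Function.update ξ i 0) ⬝ᵥ ξ i) * (ξ i ⬝ᵥ v) ∂(Measure.pi fun _ => ν) =
      ∫ ξ, W (Function.update ξ i 0) ⬝ᵥ Γ *ᵥ v ∂(Measure.pi fun _ => ν) := by
  rw [integral_eq_integral_integral_update_zero i (fun η x => (W η ⬝ᵥ x) * (x ⬝ᵥ v))
    (h.integrable_loo_mul hW hc v)]
  simp_rw [h.integral_dotProduct_mul_dotProduct (transpose_eq_of_posSemidef hΓ)]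

end LeaveOneOut

/-! ### Concentration of the leave-one-out denominators. -/

section TraceConcentration

variable {m d : ℕ} {ν : Measure (Fin d → ℝ)}
  {Γ : Matrix (Fin d) (Fin d) ℝ} {κ lam t : ℝ}

theorem trace_mul_sampleResolvent_nonneg (hlam : 0 < lam) (ht : 0 ≤ t) (hΓ : Γ.PosSemidef)
    (ξ : Fin m → Fin d → ℝ) : 0 ≤ (Γ * sampleResolvent lam t ξ).trace :=
  trace_mul_nonneg_of_posSemidef hΓ (posSemidef_resolvent hlam (posSemidef_sampleCov ht ξ))

theorem abs_trace_mul_sampleResolvent_le (hlam : 0 < lam) (ht : 0 ≤ t)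
    (ξ : Fin m → Fin d → ℝ) : |(Γ * sampleResolvent lam t ξ).trace| ≤ d * (‖Γ‖ * lam⁻¹) := by
  refine (abs_trace_le _).trans ?_
  gcongr
  refine (norm_mul_le _ _).trans ?_
  gcongr
  exact norm_sampleResolvent_le hlam ht ξ

theorem continuous_trace_mul_sampleResolvent (hlam : 0 < lam) (ht : 0 ≤ t) :
    Continuous fun ξ : Fin m → Fin d → ℝ => (Γ * sampleResolvent lam t ξ).trace :=
  (continuous_const.matrix_mul (continuous_sampleResolvent hlam ht)).matrix_trace

/-- The deterministic counterpart `1 + t E tr (Γ R)` of the leave-one-out denominators. -/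
noncomputable def meanDenom (ν : Measure (Fin d → ℝ)) (Γ : Matrix (Fin d) (Fin d) ℝ) (m : ℕ)
    (lam t : ℝ) : ℝ :=
  1 + t * ∫ ξ : Fin m → Fin d → ℝ, (Γ * sampleResolvent lam t ξ).trace ∂(Measure.pi fun _ => ν)

theorem one_le_meanDenom (hlam : 0 < lam) (ht : 0 ≤ t) (hΓ : Γ.PosSemidef) :
    1 ≤ meanDenom ν Γ m lam t := by
  have h1 : 0 ≤ ∫ ξ : Fin m → Fin d → ℝ, (Γ * sampleResolvent lam t ξ).trace
      ∂(Measure.pi fun _ => ν) :=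
    integral_nonneg fun ξ => trace_mul_sampleResolvent_nonneg hlam ht hΓ ξ
  have := mul_nonneg ht h1
  rw [meanDenom]
  linarith

variable [IsProbabilityMeasure ν]

theorem integral_sub_integral_trace_sq_le (hlam : 0 < lam) (ht : 0 ≤ t) (hΓ : Γ.PosSemidef) :
    ∫ ξ : Fin m → Fin d → ℝ, ((Γ * sampleResolvent lam t ξ).trace -
      ∫ η : Fin m → Fin d → ℝ, (Γ * sampleResolvent lam t η).trace ∂(Measure.pi fun _ => ν)) ^ 2
        ∂(Measure.pi fun _ => ν) ≤ m * (‖Γ‖ * lam⁻¹) ^ 2 :=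
  integral_sub_integral_sq_le_of_update (continuous_trace_mul_sampleResolvent hlam ht).measurable
    (abs_trace_mul_sampleResolvent_le hlam ht)
    (abs_trace_mul_sampleResolvent_sub_update_le hlam ht hΓ)

theorem continuous_loo_quadratic (hlam : 0 < lam) (ht : 0 ≤ t) (i : Fin m) :
    Continuous fun ξ : Fin m → Fin d → ℝ =>
      ξ i ⬝ᵥ sampleResolvent lam t (Function.update ξ i 0) *ᵥ ξ i :=
  (continuous_apply i).dotProduct
    (((continuous_sampleResolvent hlam ht).comp (continuous_update_zero i)).matrix_mulVec
      (continuous_apply i))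

theorem continuous_looDenom (hlam : 0 < lam) (ht : 0 ≤ t) (i : Fin m) :
    Continuous fun ξ : Fin m → Fin d → ℝ => looDenom lam t ξ i :=
  continuous_const.add (continuous_const.mul (continuous_loo_quadratic hlam ht i))

theorem HasQuadraticMoments.integrable_loo_quadratic_sub_trace_sq
    (h : HasQuadraticMoments ν Γ κ) (hlam : 0 < lam) (ht : 0 ≤ t) (i : Fin m) :
    Integrable (fun ξ : Fin m → Fin d → ℝ =>
      (ξ i ⬝ᵥ sampleResolvent lam t (Function.update ξ i 0) *ᵥ ξ i -
        (Γ * sampleResolvent lam t (Function.update ξ i 0)).trace) ^ 2)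
      (Measure.pi fun _ => ν) := by
  refine h.integrable_of_abs_le i (((continuous_loo_quadratic hlam ht i).sub
    ((continuous_trace_mul_sampleResolvent hlam ht).comp (continuous_update_zero i))).pow 2)
    (C := 2 * (lam⁻¹) ^ 2 + 2 * (d * (‖Γ‖ * lam⁻¹)) ^ 2) fun ξ => ?_
  have h1 := abs_trace_mul_sampleResolvent_le (Γ := Γ) hlam ht (Function.update ξ i 0)
  have h2 := dotProduct_mulVec_self_le (sampleResolvent lam t (Function.update ξ i 0)) (ξ i)
  have h3 := dotProduct_resolvent_nonneg hlam (posSemidef_sampleCov ht (Function.update ξ i 0)) (ξ i)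
  rw [← sampleResolvent] at h3
  have h4 := norm_sampleResolvent_le hlam ht (Function.update ξ i 0)
  have h5 := zero_le_dotProduct_self (ξ i)
  have h6 := h2.trans (mul_le_mul_of_nonneg_right h4 h5)
  have h7 := pow_le_pow_left₀ h3 h6 2
  have h8 := pow_le_pow_left₀ (abs_nonneg _) h1 2
  rw [sq_abs] at h8
  rw [abs_of_nonneg (sq_nonneg _)]
  set p := ξ i ⬝ᵥ sampleResolvent lam t (Function.update ξ i 0) *ᵥ ξ i
  set r := (Γ * sampleResolvent lam t (Function.update ξ i 0)).trace
  have h9 : (p - r) ^ 2 ≤ 2 * p ^ 2 + 2 * r ^ 2 := by nlinarith [sq_nonneg (p + r)]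
  rw [mul_pow] at h7
  have h10 : 0 ≤ (d * (‖Γ‖ * lam⁻¹)) ^ 2 * (ξ i ⬝ᵥ ξ i) ^ 2 := by positivity
  have h11 : 0 ≤ lam⁻¹ ^ 2 := by positivity
  linarith

theorem HasQuadraticMoments.integral_loo_quadratic_sub_trace_sq_le
    (h : HasQuadraticMoments ν Γ κ) (hκ : 0 ≤ κ) (hlam : 0 < lam) (ht : 0 ≤ t) (i : Fin m) :
    ∫ ξ : Fin m → Fin d → ℝ,
      (ξ i ⬝ᵥ sampleResolvent lam t (Function.update ξ i 0) *ᵥ ξ i -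
        (Γ * sampleResolvent lam t (Function.update ξ i 0)).trace) ^ 2
      ∂(Measure.pi fun _ => ν) ≤ κ * (d * (‖Γ‖ * lam⁻¹) ^ 2) := by
  refine integral_update_zero_le i (fun η x => (x ⬝ᵥ sampleResolvent lam t η *ᵥ x -
    (Γ * sampleResolvent lam t η).trace) ^ 2)
    (h.integrable_loo_quadratic_sub_trace_sq hlam ht i) (fun η x => sq_nonneg _) fun η => ?_
  refine (h.integral_sq_le_norm hκ (transpose_sampleResolvent ht η)).trans ?_
  have := norm_sampleResolvent_le hlam ht η
  gcongr

/-- Three errors, whence the factor 3: the fluctuation of `tr (Γ R)` about its mean (`m`), the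
removal of one vector (`1`), and the fluctuation of the quadratic form about its conditional mean
(`κ d`). -/
theorem HasQuadraticMoments.meanDenom_sub_looDenom_sq
    (h : HasQuadraticMoments ν Γ κ) (hκ : 0 ≤ κ) (hΓ : Γ.PosSemidef) (hlam : 0 < lam)
    (ht : 0 ≤ t) (i : Fin m) :
    Integrable (fun ξ : Fin m → Fin d → ℝ => (meanDenom ν Γ m lam t - looDenom lam t ξ i) ^ 2)
      (Measure.pi fun _ => ν) ∧
    ∫ ξ : Fin m → Fin d → ℝ, (meanDenom ν Γ m lam t - looDenom lam t ξ i) ^ 2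
      ∂(Measure.pi fun _ => ν) ≤ 3 * t ^ 2 * (‖Γ‖ * lam⁻¹) ^ 2 * (m + 1 + κ * d) := by
  set μ : Measure (Fin m → Fin d → ℝ) := Measure.pi fun _ => ν with hμ
  set f : (Fin m → Fin d → ℝ) → ℝ := fun ξ => (Γ * sampleResolvent lam t ξ).trace with hf
  set e := ∫ ξ, f ξ ∂μ with he
  set s := ‖Γ‖ * lam⁻¹ with hs
  set g : (Fin m → Fin d → ℝ) → ℝ := fun ξ =>
    (ξ i ⬝ᵥ sampleResolvent lam t (Function.update ξ i 0) *ᵥ ξ i -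
        (Γ * sampleResolvent lam t (Function.update ξ i 0)).trace) ^ 2 with hg
  have hgi : Integrable g μ := h.integrable_loo_quadratic_sub_trace_sq hlam ht i
  have hgle : ∫ ξ, g ξ ∂μ ≤ κ * (d * s ^ 2) :=
    h.integral_loo_quadratic_sub_trace_sq_le hκ hlam ht i
  have hcf : Continuous f := continuous_trace_mul_sampleResolvent hlam ht
  have hfb : ∀ ξ, |f ξ| ≤ d * s := abs_trace_mul_sampleResolvent_le hlam ht
  have hvi : Integrable (fun ξ => (f ξ - e) ^ 2) μ := by
    refine HessianSketch.integrable_of_abs_le (C := (d * s + d * s) ^ 2)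
      ((hcf.measurable.sub_const _).pow_const 2) fun ξ => ?_
    rw [abs_pow]
    exact pow_le_pow_left₀ (abs_nonneg _)
      ((abs_sub _ _).trans (add_le_add (hfb ξ) (abs_integral_le_of_abs_le hfb))) 2
  have hvle : ∫ ξ, (f ξ - e) ^ 2 ∂μ ≤ m * s ^ 2 := integral_sub_integral_trace_sq_le hlam ht hΓ
  have hpt : ∀ ξ, (meanDenom ν Γ m lam t - looDenom lam t ξ i) ^ 2 ≤
      3 * t ^ 2 * ((f ξ - e) ^ 2 + (s ^ 2 + g ξ)) := by
    intro ξ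
    have h1 := trace_mul_sampleResolvent_update_sub hlam ht hΓ ξ i
    set f' := (Γ * sampleResolvent lam t (Function.update ξ i 0)).trace with hf'
    set q := ξ i ⬝ᵥ sampleResolvent lam t (Function.update ξ i 0) *ᵥ ξ i with hq
    have h2 : meanDenom ν Γ m lam t - looDenom lam t ξ i =
        t * (-(f ξ - e) + (-(f' - f ξ)) + (-(q - f'))) := by
      rw [meanDenom, looDenom]
      ring
    have h3 : (f' - f ξ) ^ 2 ≤ s ^ 2 := pow_le_pow_left₀ h1.1 h1.2 2
    have h4 : ∀ a b c : ℝ, (-a + (-b) + (-c)) ^ 2 ≤ 3 * (a ^ 2 + (b ^ 2 + c ^ 2)) := fun a b c => by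
      nlinarith [sq_nonneg (a - b), sq_nonneg (b - c), sq_nonneg (a - c)]
    rw [h2, mul_pow]
    calc t ^ 2 * (-(f ξ - e) + (-(f' - f ξ)) + (-(q - f'))) ^ 2
        ≤ t ^ 2 * (3 * ((f ξ - e) ^ 2 + ((f' - f ξ) ^ 2 + (q - f') ^ 2))) := by
          gcongr
          exact h4 _ _ _
      _ ≤ t ^ 2 * (3 * ((f ξ - e) ^ 2 + (s ^ 2 + (q - f') ^ 2))) := by gcongr
      _ = _ := by ring
  have hsg : Integrable (fun ξ => s ^ 2 + g ξ) μ := (integrable_const _).add hgi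
  have hbi : Integrable (fun ξ => 3 * t ^ 2 * ((f ξ - e) ^ 2 + (s ^ 2 + g ξ))) μ :=
    (hvi.add hsg).const_mul _
  have hint : Integrable (fun ξ : Fin m → Fin d → ℝ =>
      (meanDenom ν Γ m lam t - looDenom lam t ξ i) ^ 2) μ := by
    refine hbi.mono' (((continuous_const.sub (continuous_looDenom hlam ht i)).pow
      2).measurable.aestronglyMeasurable) (ae_of_all _ fun ξ => ?_)
    rw [Real.norm_of_nonneg (sq_nonneg _)]
    exact hpt ξ
  refine ⟨hint, (integral_mono hint hbi hpt).trans ?_⟩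
  rw [integral_const_mul, integral_add hvi hsg, integral_add (integrable_const _) hgi,
    integral_const, probReal_univ, one_smul, mul_assoc (3 * t ^ 2)]
  gcongr
  linarith

end TraceConcentration

/-! ### Linear functionals of matrix-valued integrals. -/

section MatrixIntegral

variable {Ω : Type*} [MeasurableSpace Ω] {P : Measure Ω} {d : ℕ}
  {Φ : Ω → Matrix (Fin d) (Fin d) ℝ}

theorem dotProduct_integral_mulVec (hΦ : Integrable Φ P) (u v : Fin d → ℝ) :
    u ⬝ᵥ (∫ ω, Φ ω ∂P) *ᵥ v = ∫ ω, u ⬝ᵥ Φ ω *ᵥ v ∂P := by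
  let L : Matrix (Fin d) (Fin d) ℝ →ₗ[ℝ] ℝ :=
    { toFun := fun B => u ⬝ᵥ B *ᵥ v
      map_add' := fun B C => by rw [Matrix.add_mulVec, dotProduct_add]
      map_smul' := fun c B => by rw [Matrix.smul_mulVec, dotProduct_smul]; rfl }
  exact (L.toContinuousLinearMap.integral_comp_comm hΦ).symm

theorem trace_mul_integral (hΦ : Integrable Φ P) (Γ : Matrix (Fin d) (Fin d) ℝ) :
    (Γ * ∫ ω, Φ ω ∂P).trace = ∫ ω, (Γ * Φ ω).trace ∂P := by
  let L : Matrix (Fin d) (Fin d) ℝ →ₗ[ℝ] ℝ :=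
    { toFun := fun B => (Γ * B).trace
      map_add' := fun B C => by rw [Matrix.mul_add, Matrix.trace_add]
      map_smul' := fun c B => by rw [Matrix.mul_smul, Matrix.trace_smul]; rfl }
  exact (L.toContinuousLinearMap.integral_comp_comm hΦ).symm

end MatrixIntegral

/-- As `q, τ ≥ 1`, `|1/q - 1/τ| ≤ |τ - q|`. Young's inequality with weight `ρ` separates `α β` from
`τ - q`; the free `ρ` later balances bounded fourth moments against a small variance. -/
theorem abs_integral_mul_inv_sub_le {Ω : Type*} [MeasurableSpace Ω] {μ : Measure Ω}
    {α β q : Ω → ℝ} {τ ρ a b c : ℝ} (hρ : 0 < ρ) (hτ : 1 ≤ τ) (hq : ∀ ω, 1 ≤ q ω)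
    (hα : Integrable (fun ω => α ω ^ 4) μ) (ha : ∫ ω, α ω ^ 4 ∂μ ≤ a)
    (hβ : Integrable (fun ω => β ω ^ 4) μ) (hb : ∫ ω, β ω ^ 4 ∂μ ≤ b)
    (hδ : Integrable (fun ω => (τ - q ω) ^ 2) μ) (hc : ∫ ω, (τ - q ω) ^ 2 ∂μ ≤ c)
    (hαβ : Integrable (fun ω => α ω * β ω) μ)
    (hαβq : Integrable (fun ω => α ω * β ω * (q ω)⁻¹) μ) :
    |∫ ω, α ω * β ω * (q ω)⁻¹ ∂μ - τ⁻¹ * ∫ ω, α ω * β ω ∂μ| ≤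
      ρ / 2 * (2⁻¹ * (a + b)) + ρ⁻¹ / 2 * c := by
  rw [← integral_const_mul, ← integral_sub hαβq (hαβ.const_mul _)]
  refine (abs_integral_le_integral_abs).trans ?_
  have hi1 : Integrable (fun ω => ρ / 2 * (2⁻¹ * (α ω ^ 4 + β ω ^ 4))) μ :=
    ((hα.add hβ).const_mul _).const_mul _
  have hi2 : Integrable (fun ω => ρ⁻¹ / 2 * (τ - q ω) ^ 2) μ := hδ.const_mul _
  have hpt : ∀ ω, |α ω * β ω * (q ω)⁻¹ - τ⁻¹ * (α ω * β ω)| ≤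
      ρ / 2 * (2⁻¹ * (α ω ^ 4 + β ω ^ 4)) + ρ⁻¹ / 2 * (τ - q ω) ^ 2 := by
    intro ω
    have hq0 : 0 < q ω := by linarith [hq ω]
    have hτ0 : 0 < τ := by linarith
    have e1 : α ω * β ω * (q ω)⁻¹ - τ⁻¹ * (α ω * β ω) =
        α ω * β ω * (τ - q ω) * ((q ω)⁻¹ * τ⁻¹) := by
      field_simp
    have e2 : (q ω)⁻¹ * τ⁻¹ ≤ 1 :=
      mul_le_one₀ (inv_le_one_of_one_le₀ (hq ω)) (by positivity) (inv_le_one_of_one_le₀ hτ)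
    rw [e1, abs_mul, abs_of_pos (a := (q ω)⁻¹ * τ⁻¹) (by positivity)]
    refine (mul_le_of_le_one_right (abs_nonneg _) e2).trans ?_
    rw [abs_mul]
    generalize τ - q ω = δ
    have e3 : |α ω * β ω| * |δ| ≤ ρ / 2 * (α ω * β ω) ^ 2 + ρ⁻¹ / 2 * δ ^ 2 := by
      have : ρ / 2 * (α ω * β ω) ^ 2 + ρ⁻¹ / 2 * δ ^ 2 - |α ω * β ω| * |δ| =
          ρ⁻¹ / 2 * (ρ * |α ω * β ω| - |δ|) ^ 2 := by
        rw [← sq_abs (α ω * β ω), ← sq_abs δ]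
        field_simp
        ring
      have : 0 ≤ ρ⁻¹ / 2 * (ρ * |α ω * β ω| - |δ|) ^ 2 := by positivity
      linarith
    have e4 : (α ω * β ω) ^ 2 ≤ 2⁻¹ * (α ω ^ 4 + β ω ^ 4) := by
      nlinarith [sq_nonneg (α ω ^ 2 - β ω ^ 2)]
    have e5 := mul_le_mul_of_nonneg_left e4 (half_pos hρ).le
    linarith
  refine (integral_mono_of_nonneg (ae_of_all _ fun ω => abs_nonneg _) (hi1.add hi2)
    (ae_of_all _ hpt)).trans ?_
  rw [integral_add' hi1 hi2, integral_const_mul, integral_const_mul, integral_const_mul,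
    integral_add hα hβ]
  gcongr

/-! ### The approximate self-consistent equation for the expected resolvent. -/

section ResolventEquation

variable {m d : ℕ} {ν : Measure (Fin d → ℝ)} [IsProbabilityMeasure ν]
  {Γ : Matrix (Fin d) (Fin d) ℝ} {κ lam t : ℝ}

theorem integrable_sampleResolvent (hlam : 0 < lam) (ht : 0 ≤ t) :
    Integrable (fun ξ : Fin m → Fin d → ℝ => sampleResolvent lam t ξ)
      (Measure.pi fun _ => ν) :=
  Integrable.of_bound (continuous_sampleResolvent hlam ht).aestronglyMeasurable lam⁻¹
    (ae_of_all _ (norm_sampleResolvent_le hlam ht))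

theorem continuous_sampleResolvent_mulVec (hlam : 0 < lam) (ht : 0 ≤ t) (u : Fin d → ℝ) :
    Continuous fun ξ : Fin m → Fin d → ℝ => sampleResolvent lam t ξ *ᵥ u :=
  (continuous_sampleResolvent hlam ht).matrix_mulVec continuous_const

theorem sampleResolvent_mulVec_dotProduct_self_le (hlam : 0 < lam) (ht : 0 ≤ t) (u : Fin d → ℝ)
    (ξ : Fin m → Fin d → ℝ) :
    (sampleResolvent lam t ξ *ᵥ u) ⬝ᵥ (sampleResolvent lam t ξ *ᵥ u) ≤
      lam⁻¹ ^ 2 * (u ⬝ᵥ u) := by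
  refine (mulVec_dotProduct_self_le _ u).trans ?_
  have := zero_le_dotProduct_self u
  have := norm_sampleResolvent_le hlam ht ξ
  gcongr

theorem integrable_dotProduct_sampleResolvent_mulVec (hlam : 0 < lam) (ht : 0 ≤ t)
    (u v : Fin d → ℝ) :
    Integrable (fun ξ : Fin m → Fin d → ℝ => u ⬝ᵥ sampleResolvent lam t ξ *ᵥ v)
      (Measure.pi fun _ => ν) := by
  refine integrable_of_abs_le (C := ‖WithLp.toLp 2 u‖ * (lam⁻¹ * ‖WithLp.toLp 2 v‖))
    (continuous_const.dotProduct (continuous_sampleResolvent_mulVec hlam ht v)).measurable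
    fun ξ => (abs_dotProduct_le _ _).trans ?_
  gcongr
  refine (norm_toLp_mulVec_le _ _).trans ?_
  gcongr
  exact norm_sampleResolvent_le hlam ht ξ

theorem integrable_dotProduct_sampleResolvent_update_mulVec (hlam : 0 < lam) (ht : 0 ≤ t)
    (i : Fin m) (u v : Fin d → ℝ) :
    Integrable (fun ξ : Fin m → Fin d → ℝ =>
      u ⬝ᵥ sampleResolvent lam t (Function.update ξ i 0) *ᵥ v) (Measure.pi fun _ => ν) := by
  refine integrable_of_abs_le (C := ‖WithLp.toLp 2 u‖ * (lam⁻¹ * ‖WithLp.toLp 2 v‖))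
    (continuous_const.dotProduct ((continuous_sampleResolvent_mulVec hlam ht v).comp
      (continuous_update_zero i))).measurable
    fun ξ => (abs_dotProduct_le _ _).trans ?_
  gcongr
  refine (norm_toLp_mulVec_le _ _).trans ?_
  gcongr
  exact norm_sampleResolvent_le hlam ht _

/-- Removing one vector changes the expected resolvent by `O(t)`. -/
theorem HasQuadraticMoments.abs_integral_sampleResolvent_update_sub_le
    (h : HasQuadraticMoments ν Γ κ) (hΓ : Γ.PosSemidef) (hlam : 0 < lam) (ht : 0 ≤ t)
    (i : Fin m) (u v : Fin d → ℝ) :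
    |∫ ξ : Fin m → Fin d → ℝ, u ⬝ᵥ sampleResolvent lam t (Function.update ξ i 0) *ᵥ v
        ∂(Measure.pi fun _ => ν) -
      ∫ ξ : Fin m → Fin d → ℝ, u ⬝ᵥ sampleResolvent lam t ξ *ᵥ v ∂(Measure.pi fun _ => ν)| ≤
      t / 2 * (‖Γ‖ * lam⁻¹ ^ 2 * (u ⬝ᵥ u + v ⬝ᵥ v)) := by
  have hWc := fun w : Fin d → ℝ => continuous_sampleResolvent_mulVec (m := m) hlam ht w
  have hWb := fun w : Fin d → ℝ => sampleResolvent_mulVec_dotProduct_self_le (m := m) hlam ht w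
  have hi := fun w : Fin d → ℝ => h.integrable_loo_sq (i := i) (hWc w) (hWb w)
  have hle := fun w : Fin d → ℝ => h.integral_loo_sq_le (i := i) hΓ (hWc w) (hWb w)
  rw [← integral_sub (integrable_dotProduct_sampleResolvent_update_mulVec hlam ht i u v)
    (integrable_dotProduct_sampleResolvent_mulVec hlam ht u v)]
  refine (abs_integral_le_integral_abs).trans ?_
  refine (integral_mono_of_nonneg (ae_of_all _ fun ξ => abs_nonneg _)
    (((hi u).add (hi v)).const_mul (t / 2)) (ae_of_all _ fun ξ =>
      abs_dotProduct_sampleResolvent_update_sub_le hlam ht ξ i u v)).trans ?_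
  rw [integral_const_mul, integral_add' (hi u) (hi v)]
  gcongr
  linarith [hle u, hle v]

theorem HasQuadraticMoments.integrable_loo_mul_inv (h : HasQuadraticMoments ν Γ κ)
    (hlam : 0 < lam) (ht : 0 ≤ t) (i : Fin m) (u v : Fin d → ℝ) :
    Integrable (fun ξ : Fin m → Fin d → ℝ =>
      ((sampleResolvent lam t (Function.update ξ i 0) *ᵥ u) ⬝ᵥ ξ i) *
        (ξ i ⬝ᵥ v) * (looDenom lam t ξ i)⁻¹) (Measure.pi fun _ => ν) := by
  have hq := fun ξ : Fin m → Fin d → ℝ => one_le_looDenom hlam ht ξ i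
  have hcq : Continuous fun ξ : Fin m → Fin d → ℝ => (looDenom lam t ξ i)⁻¹ :=
    (continuous_looDenom hlam ht i).inv₀ fun ξ => by linarith [hq ξ]
  refine (h.integrable_loo_mul (continuous_sampleResolvent_mulVec hlam ht u)
    (sampleResolvent_mulVec_dotProduct_self_le hlam ht u) v).mul_bdd (c := 1)
    hcq.measurable.aestronglyMeasurable (ae_of_all _ fun ξ => ?_)
  rw [Real.norm_of_nonneg (inv_nonneg.mpr (zero_le_one.trans (hq ξ)))]
  exact inv_le_one_of_one_le₀ (hq ξ)

/-- Replacing a leave-one-out denominator by its deterministic counterpart. -/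
theorem HasQuadraticMoments.abs_integral_loo_mul_inv_sub_le
    (h : HasQuadraticMoments ν Γ κ) (hκ : 0 ≤ κ) (hΓ : Γ.PosSemidef) (hlam : 0 < lam)
    (ht : 0 ≤ t) (i : Fin m) {ρ : ℝ} (hρ : 0 < ρ) {u v : Fin d → ℝ} (hu : u ⬝ᵥ u = 1)
    (hv : v ⬝ᵥ v = 1) :
    |∫ ξ : Fin m → Fin d → ℝ, ((sampleResolvent lam t (Function.update ξ i 0) *ᵥ u) ⬝ᵥ ξ i) *
        (ξ i ⬝ᵥ v) * (looDenom lam t ξ i)⁻¹ ∂(Measure.pi fun _ => ν) -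
      (meanDenom ν Γ m lam t)⁻¹ * ∫ ξ : Fin m → Fin d → ℝ,
        ((sampleResolvent lam t (Function.update ξ i 0) *ᵥ u) ⬝ᵥ ξ i) * (ξ i ⬝ᵥ v)
          ∂(Measure.pi fun _ => ν)| ≤
      ρ / 2 * ((κ + 1) * ((‖Γ‖ * lam⁻¹ ^ 2) ^ 2 + ‖Γ‖ ^ 2)) +
        ρ⁻¹ / 2 * (3 * t ^ 2 * (‖Γ‖ * lam⁻¹) ^ 2 * (m + 1 + κ * d)) := by
  have hWc := continuous_sampleResolvent_mulVec (m := m) hlam ht u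
  have hWb : ∀ ξ : Fin m → Fin d → ℝ,
      (sampleResolvent lam t ξ *ᵥ u) ⬝ᵥ (sampleResolvent lam t ξ *ᵥ u) ≤ lam⁻¹ ^ 2 := fun ξ => by
    simpa [hu] using sampleResolvent_mulVec_dotProduct_self_le hlam ht u ξ
  obtain ⟨hδ, hδle⟩ := h.meanDenom_sub_looDenom_sq hκ hΓ hlam ht i
  have hβ4 := h.integrable_loo_pow_four (i := i) (W := fun _ => v) (c := 1) continuous_const
      fun _ => hv.le
  have hβ4le := h.integral_loo_pow_four_le (i := i) hκ hΓ (W := fun _ => v) (c := 1)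
    continuous_const fun _ => hv.le
  simp_rw [fun ξ : Fin m → Fin d → ℝ => dotProduct_comm v (ξ i)] at hβ4 hβ4le
  have hα4 := h.integrable_loo_pow_four (i := i) hWc hWb
  have hα4le := h.integral_loo_pow_four_le (i := i) hκ hΓ hWc hWb
  have hαβ := h.integrable_loo_mul (i := i) hWc hWb v
  have hαβq := h.integrable_loo_mul_inv hlam ht i u v
  have hτ := one_le_meanDenom (ν := ν) (m := m) hlam ht hΓ
  have hq := fun ξ : Fin m → Fin d → ℝ => one_le_looDenom hlam ht ξ i
  have key := abs_integral_mul_inv_sub_le hρ hτ hq hα4 hα4le hβ4 hβ4le hδ hδle hαβ hαβq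
  refine key.trans (le_of_eq ?_)
  ring

/-- The numerator of the rate `O(m ^ (-1/2))` in `norm_one_sub_resolvent_equation_le`. -/
noncomputable def resolventRate (a lam g κ : ℝ) : ℝ :=
  a * (2⁻¹ * ((κ + 1) * ((g * lam⁻¹ ^ 2) ^ 2 + g ^ 2)) +
    2⁻¹ * (3 * a ^ 2 * (g * lam⁻¹) ^ 2 * (2 + κ)) + a / 2 * (g * lam⁻¹ ^ 2 * (1 + g ^ 2)))

theorem HasQuadraticMoments.abs_resolvent_equation_le
    (h : HasQuadraticMoments ν Γ κ) (hκ : 0 ≤ κ) (hΓ : Γ.PosSemidef) (hlam : 0 < lam)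
    {a : ℝ} (ha : 0 ≤ a) (hm : 0 < m) (hdm : d ≤ m) {u v : Fin d → ℝ} (hu : u ⬝ᵥ u = 1)
    (hv : v ⬝ᵥ v = 1) :
    |u ⬝ᵥ v - lam * ∫ ξ : Fin m → Fin d → ℝ, u ⬝ᵥ sampleResolvent lam (a / m) ξ *ᵥ v
        ∂(Measure.pi fun _ => ν) -
      a / meanDenom ν Γ m lam (a / m) * ∫ ξ : Fin m → Fin d → ℝ,
        u ⬝ᵥ sampleResolvent lam (a / m) ξ *ᵥ (Γ *ᵥ v) ∂(Measure.pi fun _ => ν)| ≤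
      resolventRate a lam ‖Γ‖ κ / √m := by
  have hm0 : (0 : ℝ) < m := by exact_mod_cast hm
  have ht : 0 ≤ a / m := by positivity
  set t := a / m with ht_def
  set μ : Measure (Fin m → Fin d → ℝ) := Measure.pi fun _ => ν with hμ
  set τ := meanDenom ν Γ m lam t with hτ_def
  have hτ : 1 ≤ τ := one_le_meanDenom hlam ht hΓ
  set X := ∫ ξ : Fin m → Fin d → ℝ, u ⬝ᵥ sampleResolvent lam t ξ *ᵥ (Γ *ᵥ v) ∂μ with hX
  set Y : Fin m → ℝ := fun i => ∫ ξ : Fin m → Fin d → ℝ,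
    ((sampleResolvent lam t (Function.update ξ i 0) *ᵥ u) ⬝ᵥ ξ i) * (ξ i ⬝ᵥ v) *
      (looDenom lam t ξ i)⁻¹ ∂μ with hY
  -- The Young weight is `m^(-1/2)`: fourth moments are `O(1)` and the denominator variance is
  -- `O(1/m)`, so both terms become `O(m^(-1/2))`.
  have hρ : 0 < (√m)⁻¹ := by positivity
  have hsq : √(m : ℝ) * √m = m := Real.mul_self_sqrt hm0.le
  have hs1 : 1 ≤ √(m : ℝ) := Real.one_le_sqrt.mpr (by exact_mod_cast hm)
  have hexp : u ⬝ᵥ v = lam * ∫ ξ, u ⬝ᵥ sampleResolvent lam t ξ *ᵥ v ∂μ + t * ∑ i, Y i := by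
    have hint := fun i : Fin m => h.integrable_loo_mul_inv hlam ht i u v
    have h1 : ∫ _ : Fin m → Fin d → ℝ, u ⬝ᵥ v ∂μ = u ⬝ᵥ v := by simp
    rw [← h1, integral_congr_ae (ae_of_all _ fun ξ =>
      dotProduct_eq_sampleResolvent_add_sum hlam ht ξ u v), integral_add ((integrable_dotProduct_sampleResolvent_mulVec hlam ht u v).const_mul _)
      ((integrable_finsetSum _ fun i _ => hint i).const_mul _), integral_const_mul,
      integral_const_mul, integral_finsetSum _ fun i _ => hint i]
  have hYX : ∀ i, |Y i - τ⁻¹ * X| ≤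
      (2⁻¹ * ((κ + 1) * ((‖Γ‖ * lam⁻¹ ^ 2) ^ 2 + ‖Γ‖ ^ 2)) +
        2⁻¹ * (3 * a ^ 2 * (‖Γ‖ * lam⁻¹) ^ 2 * (2 + κ)) +
          a / 2 * (‖Γ‖ * lam⁻¹ ^ 2 * (1 + ‖Γ‖ ^ 2))) / √m := by
    intro i
    have h1 := h.abs_integral_loo_mul_inv_sub_le hκ hΓ hlam ht i hρ hu hv
    rw [h.integral_loo_mul hΓ (continuous_sampleResolvent_mulVec hlam ht u)
      (sampleResolvent_mulVec_dotProduct_self_le hlam ht u)] at h1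
    simp_rw [fun ξ : Fin m → Fin d → ℝ => (dotProduct_mulVec_comm_of_transpose_eq
      (transpose_sampleResolvent (lam := lam) ht (Function.update ξ i 0)) u (Γ *ᵥ v)).symm] at h1
    have h2 := h.abs_integral_sampleResolvent_update_sub_le hΓ hlam ht i u (Γ *ᵥ v)
    rw [← hμ, ← hX] at h2
    -- Intermediate between `Y i` and `τ⁻¹ * X`: the denominator is already replaced by `τ`, but the
    -- resolvent still omits vector `i`.
    set Z := ∫ ξ : Fin m → Fin d → ℝ,
      u ⬝ᵥ sampleResolvent lam t (Function.update ξ i 0) *ᵥ (Γ *ᵥ v) ∂μ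
    have h3 : (Γ *ᵥ v) ⬝ᵥ (Γ *ᵥ v) ≤ ‖Γ‖ ^ 2 := by
      simpa [hv] using mulVec_dotProduct_self_le Γ v
    have h4 : |τ⁻¹ * Z - τ⁻¹ * X| ≤ t / 2 * (‖Γ‖ * lam⁻¹ ^ 2 * (1 + ‖Γ‖ ^ 2)) := by
      rw [← mul_sub, abs_mul, abs_of_nonneg (a := τ⁻¹) (by positivity)]
      refine (mul_le_of_le_one_left (abs_nonneg _) (inv_le_one_of_one_le₀ hτ)).trans (h2.trans ?_)
      rw [hu]
      gcongr
    have h5 : |Y i - τ⁻¹ * X| ≤ |Y i - τ⁻¹ * Z| + |τ⁻¹ * Z - τ⁻¹ * X| := abs_sub_le _ _ _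
    refine h5.trans ((add_le_add h1 h4).trans ?_)
    have h6 : (m : ℝ) + 1 + κ * d ≤ (2 + κ) * m := by
      have : (1 : ℝ) ≤ m := by exact_mod_cast hm
      have : (d : ℝ) ≤ m := by exact_mod_cast hdm
      nlinarith
    have h7 : √(m : ℝ) * t ^ 2 * m = a ^ 2 / √m := by
      rw [ht_def, eq_div_iff (by positivity)]
      calc √(m : ℝ) * (a / m) ^ 2 * m * √m = (√(m : ℝ) * √m) * (a / m) ^ 2 * m := by ring
        _ = a ^ 2 := by rw [hsq]; field_simp
    have h8 : t ≤ a / √m := by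
      rw [ht_def]
      gcongr
      nlinarith
    have h9 : (√(m : ℝ))⁻¹⁻¹ / 2 * (3 * t ^ 2 * (‖Γ‖ * lam⁻¹) ^ 2 * (m + 1 + κ * d)) ≤
        2⁻¹ * (3 * a ^ 2 * (‖Γ‖ * lam⁻¹) ^ 2 * (2 + κ)) / √m := by
      calc (√(m : ℝ))⁻¹⁻¹ / 2 * (3 * t ^ 2 * (‖Γ‖ * lam⁻¹) ^ 2 * (m + 1 + κ * d))
          ≤ (√(m : ℝ))⁻¹⁻¹ / 2 * (3 * t ^ 2 * (‖Γ‖ * lam⁻¹) ^ 2 * ((2 + κ) * m)) := by gcongr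
        _ = 2⁻¹ * (3 * (√(m : ℝ) * t ^ 2 * m) * (‖Γ‖ * lam⁻¹) ^ 2 * (2 + κ)) := by
            rw [inv_inv]
            ring
        _ = _ := by rw [h7]; ring
    have h10 : t / 2 * (‖Γ‖ * lam⁻¹ ^ 2 * (1 + ‖Γ‖ ^ 2)) ≤
        a / 2 * (‖Γ‖ * lam⁻¹ ^ 2 * (1 + ‖Γ‖ ^ 2)) / √m := by
      calc t / 2 * (‖Γ‖ * lam⁻¹ ^ 2 * (1 + ‖Γ‖ ^ 2))
          ≤ a / √m / 2 * (‖Γ‖ * lam⁻¹ ^ 2 * (1 + ‖Γ‖ ^ 2)) := by gcongr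
        _ = _ := by ring
    rw [add_div, add_div]
    have h11 : (√(m : ℝ))⁻¹ / 2 * ((κ + 1) * ((‖Γ‖ * lam⁻¹ ^ 2) ^ 2 + ‖Γ‖ ^ 2)) =
        2⁻¹ * ((κ + 1) * ((‖Γ‖ * lam⁻¹ ^ 2) ^ 2 + ‖Γ‖ ^ 2)) / √m := by ring
    linarith
  -- Since `t m = a`, the residual is `a` times an average of the errors, which therefore do not
  -- accumulate.
  have hfin : u ⬝ᵥ v - lam * ∫ ξ, u ⬝ᵥ sampleResolvent lam t ξ *ᵥ v ∂μ - a / τ * X =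
      t * ∑ i, (Y i - τ⁻¹ * X) := by
    rw [hexp, Finset.sum_sub_distrib, Finset.sum_const, Finset.card_univ, Fintype.card_fin,
      nsmul_eq_mul, ht_def]
    field_simp
    ring
  rw [hfin, abs_mul, abs_of_nonneg ht]
  refine (mul_le_mul_of_nonneg_left ((Finset.abs_sum_le_sum_abs _ _).trans
    (Finset.sum_le_sum fun i _ => hYX i)) ht).trans (le_of_eq ?_)
  rw [Finset.sum_const, Finset.card_univ, Fintype.card_fin, nsmul_eq_mul, ht_def, resolventRate]
  field_simp

theorem resolventRate_nonneg {a g : ℝ} (ha : 0 ≤ a) (hlam : 0 < lam) (hg : 0 ≤ g) (hκ : 0 ≤ κ) :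
    0 ≤ resolventRate a lam g κ := by
  rw [resolventRate]
  positivity

/-- The expected resolvent satisfies the self-consistent equation up to `O(m ^ (-1/2))`. -/
theorem HasQuadraticMoments.norm_one_sub_resolvent_equation_le
    (h : HasQuadraticMoments ν Γ κ) (hκ : 0 ≤ κ) (hΓ : Γ.PosSemidef) (hlam : 0 < lam)
    {a : ℝ} (ha : 0 ≤ a) (hm : 0 < m) (hdm : d ≤ m)
    {R : Matrix (Fin d) (Fin d) ℝ}
    (hR : R = ∫ ξ : Fin m → Fin d → ℝ, sampleResolvent lam (a / m) ξ ∂(Measure.pi fun _ => ν)) :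
    ‖1 - R * ((a / (1 + a / m * (Γ * R).trace)) • Γ + lam • 1)‖ ≤
      resolventRate a lam ‖Γ‖ κ / √m := by
  have ht : 0 ≤ a / m := by positivity
  have hi := integrable_sampleResolvent (m := m) (ν := ν) hlam ht
  -- The trace is linear, so the mean denominator is a function of the expected resolvent alone and
  -- the equation closes.
  have hτ : 1 + a / m * (Γ * R).trace = meanDenom ν Γ m lam (a / m) := by
    rw [hR, trace_mul_integral hi, meanDenom]
  refine norm_le_of_abs_dotProduct_mulVec_le
    (div_nonneg (resolventRate_nonneg ha hlam (norm_nonneg _) hκ) (by positivity))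
    fun u v hu hv => ?_
  refine le_of_eq_of_le (congrArg abs ?_) (h.abs_resolvent_equation_le hκ hΓ hlam ha hm hdm hu hv)
  rw [← dotProduct_integral_mulVec hi, ← dotProduct_integral_mulVec hi, ← hR, ← hτ,
    Matrix.sub_mulVec, dotProduct_sub, Matrix.one_mulVec, ← Matrix.mulVec_mulVec,
    Matrix.add_mulVec, Matrix.smul_mulVec, Matrix.smul_mulVec, Matrix.one_mulVec,
    Matrix.mulVec_add, Matrix.mulVec_smul, Matrix.mulVec_smul, dotProduct_add, dotProduct_smul,
    dotProduct_smul, smul_eq_mul, smul_eq_mul]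
  ring

end ResolventEquation

/-! ### Stability of the self-consistent equation. -/

section FixedPoint

variable {d : ℕ} {lam : ℝ} {Γ : Matrix (Fin d) (Fin d) ℝ}

theorem mul_resolvent_eq_one_sub (hlam : 0 < lam) (hΓ : Γ.PosSemidef) :
    Γ * (Γ + lam • (1 : Matrix (Fin d) (Fin d) ℝ))⁻¹ = 1 - lam • (Γ + lam • 1)⁻¹ := by
  have h := mul_resolvent hlam hΓ
  rw [add_mul, Matrix.smul_mul, one_mul] at h
  exact eq_sub_of_add_eq h

theorem effectiveDim_nonneg (hlam : 0 < lam) (hΓ : Γ.PosSemidef) : 0 ≤ effectiveDim lam Γ :=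
  trace_mul_nonneg_of_posSemidef hΓ (posSemidef_resolvent hlam hΓ)

theorem effectiveDim_le (hlam : 0 < lam) (hΓ : Γ.PosSemidef) : effectiveDim lam Γ ≤ d := by
  rw [effectiveDim, mul_resolvent_eq_one_sub hlam hΓ, Matrix.trace_sub, Matrix.trace_one,
    Fintype.card_fin, Matrix.trace_smul, smul_eq_mul]
  have := mul_nonneg hlam.le (posSemidef_resolvent hlam hΓ).trace_nonneg
  linarith

/-- Cycling the trace brings the inverses together; `(Γ + lam I)(b Γ + lam I)` is a positive
semidefinite matrix plus `lam² I`, so the inverse of this product is again a resolvent. -/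
theorem trace_mul_resolvent_mul_resolvent_nonneg (hlam : 0 < lam) (hΓ : Γ.PosSemidef) {b : ℝ}
    (hb : 0 ≤ b) :
    0 ≤ ((Γ + lam • (1 : Matrix (Fin d) (Fin d) ℝ))⁻¹ * Γ * (b • Γ + lam • 1)⁻¹).trace := by
  have hK : (b • (Γ * Γ) + (lam * (1 + b)) • Γ).PosSemidef := by
    refine Matrix.PosSemidef.add (Matrix.PosSemidef.smul ?_ hb) (hΓ.smul (by positivity))
    have := Matrix.posSemidef_conjTranspose_mul_self Γ
    rwa [hΓ.isHermitian.eq] at this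
  have hprod : (Γ + lam • (1 : Matrix (Fin d) (Fin d) ℝ)) * (b • Γ + lam • 1) =
      (b • (Γ * Γ) + (lam * (1 + b)) • Γ) + (lam ^ 2) • 1 := by
    simp only [add_mul, mul_add, Matrix.smul_mul, Matrix.mul_smul, one_mul, mul_one]
    module
  rw [Matrix.mul_assoc, Matrix.trace_mul_comm, Matrix.mul_assoc, ← Matrix.mul_inv_rev, hprod]
  exact trace_mul_nonneg_of_posSemidef hΓ (posSemidef_resolvent (by positivity) hK)

/-- Stability of the self-consistent equation: an approximate solution is close to the resolvent
`(Γ + lam I)⁻¹` when the scaling `a` matches the effective dimension. -/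
theorem norm_sub_resolvent_le_of_approx (hlam : 0 < lam) (hΓ : Γ.PosSemidef) {m : ℕ} (hm : 0 < m)
    (hdm : d ≤ m) {a : ℝ} (ha : 0 ≤ a) (haeq : a * (1 - effectiveDim lam Γ / m) = 1)
    {R : Matrix (Fin d) (Fin d) ℝ} (hR : 0 ≤ (Γ * R).trace) {ε : ℝ}
    (hε : ‖1 - R * ((a / (1 + a / m * (Γ * R).trace)) • Γ + lam • 1)‖ ≤ ε) :
    ‖R - (Γ + lam • (1 : Matrix (Fin d) (Fin d) ℝ))⁻¹‖ ≤
      ε * (lam⁻¹ + a ^ 2 * ‖Γ‖ ^ 2 * lam⁻¹ ^ 3) := by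
  have hm0 : (0 : ℝ) < m := by exact_mod_cast hm
  have hden : 1 ≤ 1 + a / m * (Γ * R).trace := by
    have : 0 ≤ a / m * (Γ * R).trace := by positivity
    linarith
  set b := a / (1 + a / m * (Γ * R).trace) with hb_def
  have hb : 0 ≤ b := by positivity
  have hba : b ≤ a := div_le_self ha hden
  have hbeq : b * (1 + a / m * (Γ * R).trace) = a := div_mul_cancel₀ _ (by linarith)
  have hbΓ : (b • Γ).PosSemidef := hΓ.smul hb
  set T := (b • Γ + lam • (1 : Matrix (Fin d) (Fin d) ℝ))⁻¹ with hT
  set T₁ := (Γ + lam • (1 : Matrix (Fin d) (Fin d) ℝ))⁻¹ with hT₁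
  have hε0 : 0 ≤ ε := (norm_nonneg _).trans hε
  have hTn : ‖T‖ ≤ lam⁻¹ := norm_resolvent_le hlam hbΓ
  have hT₁n : ‖T₁‖ ≤ lam⁻¹ := norm_resolvent_le hlam hΓ
  have hTm : (b • Γ + lam • (1 : Matrix (Fin d) (Fin d) ℝ)) * T = 1 := mul_resolvent hlam hbΓ
  have hT₁m : T₁ * (Γ + lam • (1 : Matrix (Fin d) (Fin d) ℝ)) = 1 := resolvent_mul hlam hΓ
  -- `R` is near `T`, the exact resolvent with coefficient `b`; what remains is to show that `b` is
  -- near 1.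
  have hRT : T - R = (1 - R * (b • Γ + lam • 1)) * T := by
    rw [sub_mul, one_mul, Matrix.mul_assoc, hTm, mul_one]
  have hRTn : ‖T - R‖ ≤ ε * lam⁻¹ := by
    rw [hRT]
    refine (norm_mul_le _ _).trans ?_
    gcongr
  have hTT : T₁ - T = (b - 1) • (T₁ * Γ * T) := by
    have : T₁ - T = T₁ * ((b • Γ + lam • 1) * T) - T₁ * (Γ + lam • 1) * T := by
      rw [hTm, hT₁m, mul_one, one_mul]
    rw [this, ← Matrix.mul_assoc, ← sub_mul, ← mul_sub, add_sub_add_right_eq_sub,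
      show b • Γ - Γ = (b - 1) • Γ by rw [sub_smul, one_smul], Matrix.mul_smul, Matrix.smul_mul]
  set p := (T₁ * Γ * T).trace with hp
  have hp0 : 0 ≤ p := trace_mul_resolvent_mul_resolvent_nonneg hlam hΓ hb
  set e := (Γ * (T - R)).trace with he
  have hee : (Γ * R).trace = (Γ * T).trace - e := by
    rw [he, Matrix.mul_sub, Matrix.trace_sub]
    ring
  -- The trace costs a factor `d ≤ m`, cancelled below by the `1/m` in the definition of `b`.
  have hel : |e| ≤ m * (‖Γ‖ * (ε * lam⁻¹)) := by
    refine (abs_trace_le _).trans ?_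
    have : (d : ℝ) ≤ m := by exact_mod_cast hdm
    gcongr
    refine (norm_mul_le _ _).trans ?_
    gcongr
  have hbT : b * (Γ * T).trace - effectiveDim lam Γ = lam * ((b - 1) * p) := by
    have h1 := mul_resolvent_eq_one_sub hlam hbΓ
    rw [← hT, Matrix.smul_mul] at h1
    have h2 := congrArg Matrix.trace h1
    have h3 := congrArg Matrix.trace (mul_resolvent_eq_one_sub hlam hΓ)
    have h4 := congrArg Matrix.trace hTT
    rw [← hT₁] at h3
    simp only [Matrix.trace_sub, Matrix.trace_smul, smul_eq_mul] at h2 h3 h4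
    rw [effectiveDim, ← hT₁, hp, ← h4, h2, h3]
    ring
  -- Difference of the equation defining `b` and the equation `a = 1 + a d_lam/m`, which says that 1
  -- is the exact solution. As `p ≥ 0`, the factor of `b - 1` is at least 1, so it can be dropped.
  have hmain : (b - 1) * (1 + a / m * lam * p) = a / m * b * e := by
    have h1 : b + a / m * (b * (Γ * T).trace) - a / m * b * e = a := by
      have h := hbeq
      rw [hee] at h
      linear_combination h
    have h2 : a = 1 + a / m * effectiveDim lam Γ := by
      linear_combination haeq
    linear_combination h1 + h2 - a / m * hbT
  have hb1 : |b - 1| ≤ a ^ 2 * ‖Γ‖ * (ε * lam⁻¹) := by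
    have h1 : 1 ≤ 1 + a / m * lam * p := by
      have : 0 ≤ a / m * lam * p := by positivity
      linarith
    calc |b - 1| ≤ |b - 1| * (1 + a / m * lam * p) := le_mul_of_one_le_right (abs_nonneg _) h1
      _ = |a / m * b * e| := by rw [← hmain, abs_mul, abs_of_pos (a := 1 + _) (by linarith)]
      _ = a / m * b * |e| := by rw [abs_mul, abs_of_nonneg (by positivity)]
      _ ≤ a / m * a * (m * (‖Γ‖ * (ε * lam⁻¹))) := by gcongr
      _ = _ := by field_simp
  have hTTn : ‖T - T₁‖ ≤ a ^ 2 * ‖Γ‖ * (ε * lam⁻¹) * (lam⁻¹ * ‖Γ‖ * lam⁻¹) := by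
    rw [norm_sub_rev, hTT, norm_smul, Real.norm_eq_abs]
    gcongr
    refine (norm_mul_le _ _).trans ?_
    gcongr
    refine (norm_mul_le _ _).trans ?_
    gcongr
  calc ‖R - T₁‖ ≤ ‖R - T‖ + ‖T - T₁‖ := norm_sub_le_norm_sub_add_norm_sub _ _ _
    _ ≤ ε * lam⁻¹ + a ^ 2 * ‖Γ‖ * (ε * lam⁻¹) * (lam⁻¹ * ‖Γ‖ * lam⁻¹) := by
        rw [norm_sub_rev]
        gcongr
    _ = _ := by ring

end FixedPoint

/-! ### From the Gaussian sketch to a sample covariance resolvent. -/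

section GaussianProjection

variable {Ω : Type*} [MeasurableSpace Ω] {P : Measure Ω} [IsProbabilityMeasure P] {m n d : ℕ}

theorem pi_map_curry {ι κ X : Type*} [Fintype ι] [Fintype κ] [MeasurableSpace X]
    (ρ : Measure X) [IsProbabilityMeasure ρ] :
    (Measure.pi fun _ : ι × κ => ρ).map Function.curry =
      Measure.pi fun _ : ι => Measure.pi fun _ : κ => ρ := by
  have h := Measure.infinitePi_map_curry (fun (_ : ι) (_ : κ) => ρ)
  simp only [Measure.infinitePi_eq_pi] at h
  exact h

/-- The rows of a Gaussian projection, scaled by `√m`, are independent standard Gaussian vectors. -/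
theorem IsGaussianProjection.hasLaw_rows {S : Ω → Matrix (Fin m) (Fin n) ℝ}
    (hS : IsGaussianProjection P S) :
    HasLaw (fun ω i j => √m * S ω i j) (Measure.pi fun _ : Fin m => stdGaussianPi n) P := by
  have hlaw : ∀ p : Fin m × Fin n, HasLaw (fun ω => √m * S ω p.1 p.2) (gaussianReal 0 1) P := by
    intro p
    -- The row index `p.1` itself witnesses that `m` is not zero.
    have hm : (m : ℝ≥0) ≠ 0 := by
      have := p.1.pos
      positivity
    have h := gaussianReal_const_mul (hS.law p.1 p.2) √m
    convert h using 2
    · simp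
    · ext
      simp only [NNReal.coe_one, NNReal.coe_mul, NNReal.coe_mk, NNReal.coe_inv, NNReal.coe_natCast]
      rw [Real.sq_sqrt (Nat.cast_nonneg m), mul_inv_cancel₀]
      exact_mod_cast hm
  have hind : iIndepFun (fun (p : Fin m × Fin n) ω => √m * S ω p.1 p.2) P :=
    hS.indep.comp (fun _ x => √m * x) fun _ => by fun_prop
  have hmap := (iIndepFun_iff_map_fun_eq_pi_map fun p => (hlaw p).aemeasurable).mp hind
  simp_rw [fun p => (hlaw p).map_eq] at hmap
  have hae : AEMeasurable (fun ω (p : Fin m × Fin n) => √m * S ω p.1 p.2) P :=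
    aemeasurable_pi_lambda _ fun p => (hlaw p).aemeasurable
  have hc : Measurable (Function.curry : (Fin m × Fin n → ℝ) → Fin m → Fin n → ℝ) :=
    measurable_curry
  refine ⟨hc.comp_aemeasurable hae, ?_⟩
  rw [← pi_map_curry, ← hmap, AEMeasurable.map_map_of_aemeasurable hc.aemeasurable hae]
  rfl

theorem IsGaussianProjection.hasLaw_mulVec_rows {S : Ω → Matrix (Fin m) (Fin n) ℝ}
    (hS : IsGaussianProjection P S) (L : Matrix (Fin d) (Fin n) ℝ) :
    HasLaw (fun ω i => L *ᵥ fun j => √m * S ω i j)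
      (Measure.pi fun _ : Fin m => (stdGaussianPi n).map (L *ᵥ ·)) P := by
  have h := hS.hasLaw_rows
  have hL : Measurable fun (z : Fin m → Fin n → ℝ) i => L *ᵥ z i :=
    measurable_pi_lambda _ fun i => (measurable_mulVec L).comp (measurable_pi_apply i)
  have : ∀ _ : Fin m, IsProbabilityMeasure ((stdGaussianPi n).map (L *ᵥ ·)) := fun _ =>
    Measure.isProbabilityMeasure_map (measurable_mulVec L).aemeasurable
  refine ⟨hL.comp_aemeasurable h.aemeasurable, ?_⟩
  rw [← Measure.pi_map_pi fun _ => (measurable_mulVec L).aemeasurable, ← h.map_eq,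
    AEMeasurable.map_map_of_aemeasurable hL.aemeasurable h.aemeasurable]
  rfl

/-- The square root factor `n^(-1/2) Aᵀ` of `n⁻¹ AᵀA`. -/
noncomputable def scaledTranspose (A : Matrix (Fin n) (Fin d) ℝ) : Matrix (Fin d) (Fin n) ℝ :=
  (√n)⁻¹ • Aᵀ

theorem scaledTranspose_mul_transpose (A : Matrix (Fin n) (Fin d) ℝ) :
    scaledTranspose A * (scaledTranspose A)ᵀ = scaledGram A := by
  rw [scaledTranspose, Matrix.transpose_smul, Matrix.transpose_transpose, Matrix.smul_mul,
    Matrix.mul_smul, smul_smul, ← mul_inv, Real.mul_self_sqrt (Nat.cast_nonneg n), scaledGram]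

theorem posSemidef_scaledGram (A : Matrix (Fin n) (Fin d) ℝ) : (scaledGram A).PosSemidef := by
  have := Matrix.posSemidef_conjTranspose_mul_self A
  rw [Matrix.conjTranspose_eq_transpose_of_trivial] at this
  exact this.smul (by positivity)

theorem shrunkInverse_eq_sampleResolvent (hm : 0 < m) (lam : ℝ) (A : Matrix (Fin n) (Fin d) ℝ)
    (S : Matrix (Fin m) (Fin n) ℝ) :
    shrunkInverse lam A S =
      sampleResolvent lam ((1 - effectiveDim lam (scaledGram A) / (m : ℝ))⁻¹ / m)
        fun i => scaledTranspose A *ᵥ fun j => √m * S i j := by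
  have hm0 : (m : ℝ) ≠ 0 := by positivity
  have hrow : ∀ i, (scaledTranspose A *ᵥ fun j => √m * S i j) = ((√n)⁻¹ * √m) • (S * A) i := by
    intro i
    ext a
    simp only [scaledTranspose, Matrix.mulVec, dotProduct, Matrix.smul_apply, Matrix.transpose_apply,
      Pi.smul_apply, Matrix.mul_apply, smul_eq_mul, Finset.mul_sum]
    exact Finset.sum_congr rfl fun j _ => by ring
  have hsum : Aᵀ * Sᵀ * S * A = ∑ i, Matrix.vecMulVec ((S * A) i) ((S * A) i) := by
    rw [Matrix.mul_assoc, ← Matrix.transpose_mul]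
    ext a b
    simp only [Matrix.mul_apply, Matrix.sum_apply, Matrix.vecMulVec_apply, Matrix.transpose_apply]
  rw [shrunkInverse, sketchedHessian, add_sub_cancel_right, sampleResolvent, sampleCov, hsum]
  simp_rw [hrow, Matrix.smul_vecMulVec, Matrix.vecMulVec_smul, smul_smul, ← Finset.smul_sum,
    smul_smul]
  congr 3
  -- This also holds for `n = 0`, where the convention `0⁻¹ = 0` makes both sides vanish.
  have h1 : (√(n : ℝ))⁻¹ * √m * ((√(n : ℝ))⁻¹ * √m) = (n : ℝ)⁻¹ * m := by
    rw [show (√(n : ℝ))⁻¹ * √m * ((√(n : ℝ))⁻¹ * √m) = (√(n : ℝ) * √n)⁻¹ * (√m * √m) by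
      rw [mul_inv]; ring, Real.mul_self_sqrt (Nat.cast_nonneg n),
      Real.mul_self_sqrt (Nat.cast_nonneg m)]
  rw [h1]
  field_simp

theorem pos_of_effectiveDim_lt {lam : ℝ} (hlam : 0 < lam) {A : Matrix (Fin n) (Fin d) ℝ}
    (hdim : effectiveDim lam (scaledGram A) < m) : 0 < m := by
  exact_mod_cast (effectiveDim_nonneg hlam (posSemidef_scaledGram A)).trans_lt hdim

theorem one_sub_effectiveDim_div_pos {lam : ℝ} (hlam : 0 < lam) {A : Matrix (Fin n) (Fin d) ℝ}
    (hdim : effectiveDim lam (scaledGram A) < m) :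
    0 < 1 - effectiveDim lam (scaledGram A) / m := by
  have hm : (0 : ℝ) < m := by exact_mod_cast pos_of_effectiveDim_lt hlam hdim
  rw [sub_pos, div_lt_one hm]
  exact hdim

theorem IsGaussianProjection.integrable_shrunkInverse {S : Ω → Matrix (Fin m) (Fin n) ℝ}
    (hS : IsGaussianProjection P S) {lam : ℝ} (hlam : 0 < lam) {A : Matrix (Fin n) (Fin d) ℝ}
    (hdim : effectiveDim lam (scaledGram A) < m) :
    Integrable (fun ω => shrunkInverse lam A (S ω)) P := by
  have hm := pos_of_effectiveDim_lt hlam hdim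
  have hpos := one_sub_effectiveDim_div_pos hlam hdim
  have ht : 0 ≤ (1 - effectiveDim lam (scaledGram A) / (m : ℝ))⁻¹ / m := by positivity
  simp_rw [shrunkInverse_eq_sampleResolvent hm]
  refine Integrable.of_bound ?_ lam⁻¹ (ae_of_all _ fun ω => norm_sampleResolvent_le hlam ht _)
  exact (continuous_sampleResolvent hlam ht).comp_aestronglyMeasurable
    (hS.hasLaw_mulVec_rows (scaledTranspose A)).aemeasurable.aestronglyMeasurable

/-- The expected shrinkage estimator approximates `H⁻¹` at the rate `O(m ^ (-1/2))`. -/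
theorem IsGaussianProjection.norm_integral_shrunkInverse_sub_le
    {S : Ω → Matrix (Fin m) (Fin n) ℝ}
    (hS : IsGaussianProjection P S) {lam : ℝ} (hlam : 0 < lam) {A : Matrix (Fin n) (Fin d) ℝ}
    (hdim : effectiveDim lam (scaledGram A) < m) (hdm : d ≤ m) {a₀ σ : ℝ}
    (ha₀ : (1 - effectiveDim lam (scaledGram A) / (m : ℝ))⁻¹ ≤ a₀) (hσ : ‖scaledGram A‖ ≤ σ) :
    ‖(∫ ω, shrunkInverse lam A (S ω) ∂P) - (hessian lam A)⁻¹‖ ≤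
      resolventRate a₀ lam σ varianceSqGaussian / √m *
        (lam⁻¹ + a₀ ^ 2 * σ ^ 2 * lam⁻¹ ^ 3) := by
  have hm := pos_of_effectiveDim_lt hlam hdim
  have hpos := one_sub_effectiveDim_div_pos hlam hdim
  have hΓ := posSemidef_scaledGram A
  set a := (1 - effectiveDim lam (scaledGram A) / (m : ℝ))⁻¹ with ha_def
  have ha : 0 ≤ a := by positivity
  have ht : 0 ≤ a / m := by positivity
  have haeq : a * (1 - effectiveDim lam (scaledGram A) / m) = 1 := inv_mul_cancel₀ hpos.ne'
  set ν := (stdGaussianPi n).map (scaledTranspose A *ᵥ ·) with hν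
  have : IsProbabilityMeasure ν :=
    Measure.isProbabilityMeasure_map (measurable_mulVec _).aemeasurable
  have hlaw := hS.hasLaw_mulVec_rows (scaledTranspose A)
  have hmom : HasQuadraticMoments ν (scaledGram A) varianceSqGaussian := by
    rw [← scaledTranspose_mul_transpose]
    exact hasQuadraticMoments_map_stdGaussianPi _
  have hR : ∫ ω, shrunkInverse lam A (S ω) ∂P =
      ∫ ξ : Fin m → Fin d → ℝ, sampleResolvent lam (a / m) ξ ∂(Measure.pi fun _ => ν) := by
    rw [← hlaw.map_eq, integral_map hlaw.aemeasurable
      (continuous_sampleResolvent hlam ht).aestronglyMeasurable]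
    simp_rw [shrunkInverse_eq_sampleResolvent hm]
    rfl
  have hκ := varianceSqGaussian_nonneg
  have heq := hmom.norm_one_sub_resolvent_equation_le hκ hΓ hlam ha hm hdm hR
  have htr : 0 ≤ (scaledGram A * ∫ ω, shrunkInverse lam A (S ω) ∂P).trace := by
    rw [hR, trace_mul_integral (integrable_sampleResolvent hlam ht)]
    exact integral_nonneg fun ξ => trace_mul_sampleResolvent_nonneg hlam ht hΓ ξ
  refine (norm_sub_resolvent_le_of_approx hlam hΓ hm hdm ha haeq htr heq).trans ?_
  have := norm_nonneg (scaledGram A)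
  have ha₀0 : 0 ≤ a₀ := ha.trans ha₀
  have hσ0 : 0 ≤ σ := this.trans hσ
  have := resolventRate_nonneg ha₀0 hlam hσ0 hκ
  -- The rate is monotone in the scaling and in the norm, so uniform bounds on these give a uniform
  -- constant.
  have h1 : resolventRate a lam ‖scaledGram A‖ varianceSqGaussian ≤
      resolventRate a₀ lam σ varianceSqGaussian := by
    rw [resolventRate, resolventRate]
    gcongr
  gcongr

/-- Unitary conjugation preserves the operator norm, and a diagonal matrix has the sup norm of its
entries. -/
theorem norm_scaledGram_le {A : Matrix (Fin n) (Fin d) ℝ} {σ : ℝ} (hσ0 : 0 ≤ σ)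
    (hσ : ∀ i, |gramEigenvalues A i| ≤ σ) : ‖scaledGram A‖ ≤ σ := by
  rw [(scaledGram_isHermitian A).spectral_theorem, Unitary.conjStarAlgAut_apply,
    ← Unitary.coe_star, CStarRing.norm_mul_coe_unitary, CStarRing.norm_coe_unitary_mul,
    Matrix.l2_opNorm_diagonal]
  exact (pi_norm_le_iff_of_nonneg hσ0).mpr hσ

end GaussianProjection

end HessianSketch

/-! ### The limit along the sequence of data matrices. -/

theorem mainTheorem5
    {Ω₁ Ω₂ : Type*} [MeasurableSpace Ω₁] [MeasurableSpace Ω₂]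
    (Q : Measure Ω₁) [IsProbabilityMeasure Q] (P : Measure Ω₂) [IsProbabilityMeasure P]
    (n d m : ℕ → ℕ)
    (A : ∀ k, Ω₁ → Matrix (Fin (n k)) (Fin (d k)) ℝ)
    (S : ∀ k, Ω₂ → Matrix (Fin (m k)) (Fin (n k)) ℝ)
    (hS : ∀ k, HessianSketch.IsGaussianProjection P (S k))
    (hm : Tendsto m atTop atTop) (hd : Tendsto d atTop atTop)
    (y : ℝ) (hy : y ∈ Set.Ico (0 : ℝ) 1)
    (hdm : Tendsto (fun k => (d k : ℝ) / (m k : ℝ)) atTop (𝓝 y))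
    (F : ℝ → ℝ)
    (hF : ∀ᵐ ω ∂Q, ∀ᵐ u ∂(volume.restrict (Set.Ici (0 : ℝ))),
      Tendsto (fun k => HessianSketch.gramESD (A k ω) u) atTop (𝓝 (F u)))
    (σmin : ℕ → ℝ) (hσmin : ∀ k, 0 < σmin k) (σmax : ℝ)
    (hσ : ∀ᵐ ω ∂Q, ∀ k i,
      HessianSketch.gramEigenvalues (A k ω) i ∈ Set.Icc (σmin k) σmax)
    (lam : ℝ) (hlam : 0 < lam)
    (hdim : ∀ᵐ ω ∂Q, ∀ k,
      HessianSketch.effectiveDim lam (HessianSketch.scaledGram (A k ω)) < (m k : ℝ)) :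
    ∀ᵐ ω ∂Q,
      (∀ k, Integrable (fun ω' => HessianSketch.shrunkInverse lam (A k ω) (S k ω')) P) ∧
      Tendsto
        (fun k => ‖(∫ ω', HessianSketch.shrunkInverse lam (A k ω) (S k ω') ∂P) -
          (HessianSketch.hessian lam (A k ω))⁻¹‖) atTop (𝓝 0) := by
  filter_upwards [hσ, hdim] with ω hσω hdimω
  refine ⟨fun k => (hS k).integrable_shrunkInverse hlam (hdimω k), ?_⟩
  obtain ⟨-, hy1⟩ := hy
  -- The midpoint `(1 + y) / 2` lies strictly between `y` and 1. Eventually `d_lam/m ≤ d/m` stays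
  -- below it, which bounds the shrinkage factor and gives `d ≤ m`.
  set a₀ : ℝ := (1 - (1 + y) / 2)⁻¹ with ha₀
  -- The absolute value gives nonnegativity without exhibiting an eigenvalue, of which there are
  -- none when `d k = 0`.
  set σ : ℝ := |σmax| with hσ_def
  have hbound : ∀ᶠ k in atTop, ‖(∫ ω', HessianSketch.shrunkInverse lam (A k ω) (S k ω') ∂P) -
      (HessianSketch.hessian lam (A k ω))⁻¹‖ ≤
      HessianSketch.resolventRate a₀ lam σ HessianSketch.varianceSqGaussian / √(m k) *
        (lam⁻¹ + a₀ ^ 2 * σ ^ 2 * lam⁻¹ ^ 3) := by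
    filter_upwards [hdm.eventually_le_const (show y < (1 + y) / 2 by linarith)] with k hk
    have hmk : (0 : ℝ) < m k := by
      exact_mod_cast HessianSketch.pos_of_effectiveDim_lt hlam (hdimω k)
    have hle := HessianSketch.effectiveDim_le hlam
      (HessianSketch.posSemidef_scaledGram (A k ω))
    refine (hS k).norm_integral_shrunkInverse_sub_le hlam (hdimω k) ?_ ?_
      (HessianSketch.norm_scaledGram_le (abs_nonneg _) fun i => ?_)
    · have h1 : (d k : ℝ) ≤ m k := by
        rw [div_le_iff₀ hmk] at hk
        nlinarith
      exact_mod_cast h1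
    · refine inv_anti₀ (by linarith) ?_
      have : HessianSketch.effectiveDim lam (HessianSketch.scaledGram (A k ω)) / m k ≤
          d k / m k := by gcongr
      linarith
    · rw [abs_of_nonneg ((hσmin k).le.trans (hσω k i).1)]
      exact (hσω k i).2.trans (le_abs_self _)
  refine squeeze_zero' (Eventually.of_forall fun k => norm_nonneg _) hbound ?_
  have hlim : Tendsto (fun k => HessianSketch.resolventRate a₀ lam σ
      HessianSketch.varianceSqGaussian / √(m k : ℝ)) atTop (𝓝 0) :=
    (Real.tendsto_sqrt_atTop.comp (tendsto_natCast_atTop_atTop.comp hm)).const_div_atTop _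
  have h := hlim.mul_const (lam⁻¹ + a₀ ^ 2 * σ ^ 2 * lam⁻¹ ^ 3)
  rwa [zero_mul] at h
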